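/- Let $n\ge 4$ and $3\le d_1\le d_2\le\cdots\le d_n$, and let $A_1,\dots,A_n$ be parties with systems $\mathbb{C}^{d_1},\dots,\mathbb{C}^{d_n}$ and computational bases $|0\rangle,|1\rangle,\dots$. Write $|i_1\pm i_2\pm\cdots\pm i_m\rangle=\frac1{\sqrt m}(|i_1\rangle\pm|i_2\rangle\pm\cdots\pm|i_m\rangle)$ and $\omega_m=e^{2\pi\sqrt{-1}/m}$; states need not be normalized. For $3\le p\le q$ let $\mathcal{B}_{p,q}$ be the set of the following $2q-1$ product vectors $|x\rangle|y\rangle$ of $\mathbb{C}^p\otimes\mathbb{C}^q$: $$|i\rangle|0-i\rangle\ (1\le i\le p-1),\qquad |0-i\rangle|i+1\rangle\ (1\le i\le p-2),\qquad |0-(p-1)\rangle|1\rangle,\qquad |0-1\rangle|j\rangle\ (p\le j\le q-1),$$ $$|0+1\rangle\Big(|2\rangle+\sum_{t=1}^{q-p}\omega_{q-p+1}^{st}|t+p-1\rangle\Big)\ (1\le s\le q-p),\qquad |0+1+\cdots+(p-1)\rangle|0+1+\cdots+(q-1)\rangle .$$ In $\bigotimes_{i=1}^n\mathbb{C}^{d_i}$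 define blocks $G_1,\dots,G_{n-1}$. $G_1$ consists of the states of $\mathcal{B}_{d_1,d_2}$ placed on $A_1,A_2$, with $|1\rangle$ on $A_n$ and $|0\rangle$ on all other parties. $G_2$ consists of the states of $\mathcal{B}_{d_2,d_3}$ placed on $A_2,A_3$, with $|1\rangle$ on $A_1$ and $|0\rangle$ on all other parties. For $3\le k\le n-1$, $G_k$ consists of the states of $\mathcal{B}_{d_2,d_{k+1}}$ placed on $A_2,A_{k+1}$, with $|1\rangle$ on $A_k$ and $|0\rangle$ on all other parties. Then $\mathcal{S}_3=G_1\cup\cdots\cup G_{n-1}$ is a set of exactly $\sum_{i=2}^n(2d_i-1)$ mutually orthogonal product states, and it has genuine nonlocality of type II, that is: (a) $\mathcal{S}_3$ is genuinely nonlocal: for every bipartition of $\{A_1,\dots,A_n\}$ into two nonempty groups, the states of $\mathcal{S}_3$ cannot be perfectly distinguished by local operations and classical communication (finitely many rounds of measurements with finitely many outcomes) between the two groups; (b) $\mathcal{S}_3$ is locally irreducible: when all $n$ parties are separated, no state of $\mathcal{S}_3$ can be eliminated (mapped to $0$ by an outcome sequence that has positive probability for some other state of the set) by a finite sequence of nontrivial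 orthogonality-preserving local measurements. Here a measurement of one party is orthogonality-preserving if for each outcome the post-measurement states remain mutually orthogonal, and nontrivial if not all of its POVM elements are proportional to the identity. -/

import Mathlib

noncomputable section

/-! ## States of a multipartite system -/

/-- The single-party space `ℂ^m`. -/
abbrev LocalState (m : ℕ) : Type := EuclideanSpace ℂ (Fin m)

/-- The space `⨂ i, ℂ^(d i)` of `n` parties, written in the product computational basis
`|x 0⟩|x 1⟩⋯|x (n-1)⟩`, `x i ∈ Fin (d i)`. The index `i` is the party `A_(i+1)`. -/
abbrev MultiState {n : ℕ} (d : Fin n → ℕ) : Type := EuclideanSpace ℂ ((i : Fin n) → Fin (d i))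

/-- The tensor product `v 0 ⊗ v 1 ⊗ ⋯ ⊗ v (n-1)`. -/
def productVector {n : ℕ} {d : Fin n → ℕ} (v : (i : Fin n) → LocalState (d i)) : MultiState d :=
  WithLp.toLp 2 fun x => ∏ i, v i (x i)

/-- A (not necessarily normalized) product state: a tensor product of nonzero local vectors. -/
def IsProductState {n : ℕ} {d : Fin n → ℕ} (ψ : MultiState d) : Prop :=
  ∃ v : (i : Fin n) → LocalState (d i), (∀ i, v i ≠ 0) ∧ ψ = productVector v

/-- A set of (nonzero) mutually orthogonal states. -/
def IsOrthogonalSet {n : ℕ} {d : Fin n → ℕ} (S : Set (MultiState d)) : Prop :=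
  (∀ ψ ∈ S, ψ ≠ 0) ∧ ∀ ψ ∈ S, ∀ φ ∈ S, ψ ≠ φ → inner ℂ ψ φ = 0

/-! ## Local measurements -/

/-- A measurement with finitely many outcomes on the space with orthonormal basis `X`, given by
its measurement operators `M k`; its POVM elements are `(M k)ᴴ * M k`, and they sum to `1`. -/
structure Measurement (X : Type) [Fintype X] [DecidableEq X] where
  outcomes : ℕ
  op : Fin outcomes → Matrix X X ℂ
  complete : ∑ k, (op k).conjTranspose * op k = 1

/-- The POVM elements are all proportional to the identity. -/
def Measurement.IsTrivial {X : Type} [Fintype X] [DecidableEq X] (μ : Measurement X) : Prop :=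
  ∀ k, ∃ c : ℂ, (μ.op k).conjTranspose * μ.op k = c • (1 : Matrix X X ℂ)

/-- The computational basis of the joint system of the parties in `L` (a laboratory in which
these parties are together). -/
abbrev LabBasis {n : ℕ} (d : Fin n → ℕ) (L : Finset (Fin n)) : Type := (i : L) → Fin (d i)

/-- The operator `M` on the joint system of the parties in `L`, tensored with the identity on all
the other parties, applied to `ψ`. -/
def applyLocal {n : ℕ} {d : Fin n → ℕ} (L : Finset (Fin n))
    (M : Matrix (LabBasis d L) (LabBasis d L) ℂ) (ψ : MultiState d) : MultiState d :=
  WithLp.toLp 2 fun x =>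
    ∑ a : LabBasis d L, M (fun i => x i) a * ψ (fun i => if h : i ∈ L then a ⟨i, h⟩ else x i)

/-! ## LOCC discrimination -/

/-- A protocol of local operations and classical communication between the laboratories in
`labs`: either stop and announce a state, or let some laboratory perform a measurement on its
(post-measurement) system, broadcast the outcome `k`, and go on with a protocol depending on `k`. -/
inductive LOCC {n : ℕ} (d : Fin n → ℕ) (labs : Set (Finset (Fin n))) : Type
  | announce (g : MultiState d) : LOCC d labs
  | measure (L : Finset (Fin n)) (hL : L ∈ labs) (μ : Measurement (LabBasis d L))
      (next : Fin μ.outcomes → LOCC d labs) : LOCC d labs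

/-- `P.DistinguishesFrom S K`: if `K` is the product of the measurement operators that have
occurred so far, then for every initial state in `S` the rest `P` of the protocol announces the
right state with certainty (a branch has zero probability exactly if it maps the state to `0`). -/
def LOCC.DistinguishesFrom {n : ℕ} {d : Fin n → ℕ} {labs : Set (Finset (Fin n))}
    (S : Set (MultiState d)) : LOCC d labs → (MultiState d → MultiState d) → Prop
  | .announce g, K => ∀ ψ ∈ S, K ψ ≠ 0 → ψ = g
  | .measure L _ μ next, K =>
      ∀ k, (next k).DistinguishesFrom S (fun ψ => applyLocal L (μ.op k) (K ψ))

/-- `S` cannot be perfectly distinguished by LOCC between the laboratories in `labs`. -/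
def LocallyIndistinguishable {n : ℕ} {d : Fin n → ℕ} (labs : Set (Finset (Fin n)))
    (S : Set (MultiState d)) : Prop :=
  ¬ ∃ P : LOCC d labs, P.DistinguishesFrom S (fun ψ => ψ)

/-- `S` is locally indistinguishable in every bipartition `L | Lᶜ` of the parties. -/
def GenuinelyNonlocal {n : ℕ} {d : Fin n → ℕ} (S : Set (MultiState d)) : Prop :=
  ∀ L : Finset (Fin n), L.Nonempty → Lᶜ.Nonempty → LocallyIndistinguishable {L, Lᶜ} S

/-! ## Local irreducibility -/

/-- The measurement `μ` of party `i`, performed on the states `K ψ` with `ψ ∈ S`, keeps them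
mutually orthogonal for each outcome. -/
def IsOrthogonalityPreserving {n : ℕ} {d : Fin n → ℕ} (S : Set (MultiState d))
    (K : MultiState d → MultiState d) (i : Fin n) (μ : Measurement (LabBasis d {i})) : Prop :=
  ∀ k, ∀ ψ ∈ S, ∀ φ ∈ S, ψ ≠ φ →
    inner ℂ (applyLocal {i} (μ.op k) (K ψ)) (applyLocal {i} (μ.op k) (K φ)) = 0

/-- `ReachableByOPLM S K`: starting from the states in `S`, a finite sequence of outcomes of
nontrivial orthogonality-preserving local measurements, each performed by a single party and
possibly depending on the earlier outcomes, has `K` as the product of its measurement operators. -/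
inductive ReachableByOPLM {n : ℕ} {d : Fin n → ℕ} (S : Set (MultiState d)) :
    (MultiState d → MultiState d) → Prop
  | start : ReachableByOPLM S (fun ψ => ψ)
  | step (K : MultiState d → MultiState d) (hK : ReachableByOPLM S K) (i : Fin n)
      (μ : Measurement (LabBasis d {i})) (hμ : IsOrthogonalityPreserving S K i μ)
      (hnt : ¬ μ.IsTrivial) (k : Fin μ.outcomes) :
      ReachableByOPLM S (fun ψ => applyLocal {i} (μ.op k) (K ψ))

/-- Some state of `S` can be eliminated by nontrivial orthogonality-preserving local measurements,
in a branch that occurs with positive probability for some other state of `S`. -/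
def LocallyReducible {n : ℕ} {d : Fin n → ℕ} (S : Set (MultiState d)) : Prop :=
  ∃ K, ReachableByOPLM S K ∧ (∃ φ ∈ S, K φ ≠ 0) ∧ ∃ ψ ∈ S, K ψ = 0

def LocallyIrreducible {n : ℕ} {d : Fin n → ℕ} (S : Set (MultiState d)) : Prop :=
  ¬ LocallyReducible S

/-- Genuine nonlocality of type II. -/
def GenuinelyNonlocalTypeII {n : ℕ} {d : Fin n → ℕ} (S : Set (MultiState d)) : Prop :=
  GenuinelyNonlocal S ∧ LocallyIrreducible S

/-! ## The bipartite sets and the multipartite set -/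

/-- The computational basis vector `|j⟩` of `ℂ^m` (used for `j < m`). -/
def ket (m j : ℕ) : LocalState m := WithLp.toLp 2 fun a => if (a : ℕ) = j then 1 else 0

/-- `|0 - i⟩ = (|0⟩ - |i⟩) / √2`. -/
def ketMinus (m i : ℕ) : LocalState m := ((1 / √2 : ℝ) : ℂ) • (ket m 0 - ket m i)

/-- `|0 + 1⟩ = (|0⟩ + |1⟩) / √2`. -/
def ketPlus (m : ℕ) : LocalState m := ((1 / √2 : ℝ) : ℂ) • (ket m 0 + ket m 1)

/-- `|0 + 1 + ⋯ + (m-1)⟩ = (|0⟩ + ⋯ + |m-1⟩) / √m`. -/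
def ketAll (m : ℕ) : LocalState m := ((1 / √(m : ℝ) : ℝ) : ℂ) • ∑ j ∈ Finset.range m, ket m j

/-- `ω_m = exp (2πi / m)`. -/
def omega (m : ℕ) : ℂ := Complex.exp (2 * Real.pi * Complex.I / m)

/-- `|2⟩ + ∑_{t=1}^{m₂-m₁} ω^(s t) |t + m₁ - 1⟩` in `ℂ^m₂`, where `ω = ω_{m₂-m₁+1}`
(used for `3 ≤ m₁ ≤ m₂`). -/
def ketFourier (m₁ m₂ s : ℕ) : LocalState m₂ :=
  ket m₂ 2 + ∑ t ∈ Finset.Icc 1 (m₂ - m₁), omega (m₂ - m₁ + 1) ^ (s * t) • ket m₂ (t + m₁ - 1)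

/-- The pairs `(x, y)` of local vectors whose products `x ⊗ y` are the `2 m₂ - 1` states of the
bipartite set in `ℂ^m₁ ⊗ ℂ^m₂` (used for `3 ≤ m₁ ≤ m₂`). -/
inductive BipartitePair (m₁ m₂ : ℕ) : LocalState m₁ → LocalState m₂ → Prop
  | left (i : ℕ) (h₁ : 1 ≤ i) (h₂ : i ≤ m₁ - 1) :
      BipartitePair m₁ m₂ (ket m₁ i) (ketMinus m₂ i)
  | right (i : ℕ) (h₁ : 1 ≤ i) (h₂ : i ≤ m₁ - 2) :
      BipartitePair m₁ m₂ (ketMinus m₁ i) (ket m₂ (i + 1))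
  | rightLast : BipartitePair m₁ m₂ (ketMinus m₁ (m₁ - 1)) (ket m₂ 1)
  | extra (j : ℕ) (h₁ : m₁ ≤ j) (h₂ : j ≤ m₂ - 1) :
      BipartitePair m₁ m₂ (ketMinus m₁ 1) (ket m₂ j)
  | fourier (s : ℕ) (h₁ : 1 ≤ s) (h₂ : s ≤ m₂ - m₁) :
      BipartitePair m₁ m₂ (ketPlus m₁) (ketFourier m₁ m₂ s)
  | stopper : BipartitePair m₁ m₂ (ketAll m₁) (ketAll m₂)

/-- The bipartite set placed on parties `a` and `b`, with `|1⟩` at party `c` and `|0⟩` at all the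
other parties (used for distinct `a`, `b`, `c`). -/
def block {n : ℕ} (d : Fin n → ℕ) (a b c : Fin n) : Set (MultiState d) :=
  {ψ | ∃ x y, BipartitePair (d a) (d b) x y ∧
    ψ = productVector (Function.update
      (Function.update (fun i => ket (d i) (if i = c then 1 else 0)) a x) b y)}

/-- The blocks `G_k`, `1 ≤ k ≤ n - 1`. `G_1` is the bipartite set on `A_1, A_2` with `|1⟩` at `A_n`.
For `k ≥ 2`, `G_k` is the bipartite set on `A_2, A_(k+1)`, with `|1⟩` at `A_1` if `k = 2` and at
`A_k` if `k ≥ 3`. -/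
def blockG {n : ℕ} (hn : 4 ≤ n) (d : Fin n → ℕ) (k : ℕ) (hk : k ≤ n - 1) : Set (MultiState d) :=
  if k = 1 then
    block d ⟨0, by omega⟩ ⟨1, by omega⟩ ⟨n - 1, by omega⟩
  else
    block d ⟨1, by omega⟩ ⟨k, by omega⟩
      (if k = 2 then ⟨0, by omega⟩ else ⟨k - 1, by omega⟩)

/-- The union of the blocks `G_1, …, G_(n-1)`. -/
def unionOfBlocks {n : ℕ} (hn : 4 ≤ n) (d : Fin n → ℕ) : Set (MultiState d) :=
  {ψ | ∃ (k : ℕ) (_ : 1 ≤ k) (hk : k ≤ n - 1), ψ ∈ blockG hn d k hk}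

end

-- The bipartite set is rigid. Let a linear map `T` on one factor keep the orthogonality of every
-- pair of its states that is orthogonal on that factor only. Then `T` is a multiple of an isometry:
-- `inner (T x) (T x') = c * inner x x'`. The pairs built from `|i⟩` and `|0 - i⟩` force the images
-- of distinct basis vectors to be orthogonal. Orthogonality to the stopper `ketAll ⊗ ketAll` then
-- forces these images to have equal norms; on the larger factor the norms of the labels beyond the
-- first `p` come from the Fourier states. This is `exists_inner_map_map_eq_left` and
-- `exists_inner_map_map_eq_right`.
--
-- Genuine nonlocality: the pairs of parties that carry the blocks form a star centred at `A_2`, so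
-- every bipartition separates the two parties of some block (`exists_block_across`). The spectator
-- parties are in fixed unit states, so that block is an isometric copy of a bipartite set inside
-- the two laboratories. A laboratory may measure nontrivially on its whole space, but along a
-- successful protocol each measurement operator acts on this copy as a multiple of an isometry.
-- Completeness gives an outcome whose multiple is nonzero. Following such outcomes leads to an
-- announcement at which no state of the block has been excluded, a contradiction
-- (`not_distinguishesFrom_of_rigid`).
--
-- Irreducibility: every party is active in some block, and its one-party space is exactly a factor
-- of the bipartite set. By rigidity every orthogonality-preserving measurement on the initial
-- states is trivial, so no sequence of nontrivial ones can begin.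
--
-- Orthogonality between blocks comes from a party in state `|1⟩` in one block and `|0⟩` in the
-- other. The cardinality follows, since nonzero orthogonal vectors are distinct.

noncomputable section

/-! ## Computational basis vectors -/

theorem inner_ket_left {m j : ℕ} (hj : j < m) (v : LocalState m) :
    inner ℂ (ket m j) v = v ⟨j, hj⟩ := by
  rw [PiLp.inner_apply, Finset.sum_eq_single ⟨j, hj⟩]
  · simp [ket]
  · intro b _ hb
    have : (b : ℕ) ≠ j := fun h => hb (Fin.ext h)
    simp [ket, this]
  · simp

theorem inner_ket_ket {m i j : ℕ} (hi : i < m) :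
    inner ℂ (ket m i) (ket m j) = if i = j then (1 : ℂ) else 0 := by
  rw [inner_ket_left hi]; simp [ket]

theorem inner_ket_ket_of_ne {m i j : ℕ} (hi : i < m) (h : i ≠ j) :
    inner ℂ (ket m i) (ket m j) = (0 : ℂ) := by
  rw [inner_ket_ket hi, if_neg h]

theorem eq_sum_ket {m : ℕ} (v : LocalState m) : v = ∑ j : Fin m, v j • ket m j := by
  ext a
  simp [ket, Fin.val_inj]

theorem one_div_sqrt_ne_zero {m : ℕ} (hm : 0 < m) : ((1 / √(m : ℝ) : ℝ) : ℂ) ≠ 0 := by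
  have : 0 < √(m : ℝ) := Real.sqrt_pos.2 (by exact_mod_cast hm)
  exact_mod_cast (one_div_pos.2 this).ne'

theorem one_div_sqrt_two_ne_zero : ((1 / √2 : ℝ) : ℂ) ≠ 0 := by
  simp

-- Gram matrix of the images of basis vectors

section LinearImage

variable {m : ℕ} {H : Type*} [NormedAddCommGroup H] [InnerProductSpace ℂ H]
  (T : LocalState m →ₗ[ℂ] H)

theorem map_ketMinus (i : ℕ) :
    T (ketMinus m i) = ((1 / √2 : ℝ) : ℂ) • (T (ket m 0) - T (ket m i)) := by
  simp [ketMinus]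

theorem map_ketAll :
    T (ketAll m) = ((1 / √(m : ℝ) : ℝ) : ℂ) • ∑ j ∈ Finset.range m, T (ket m j) := by
  simp [ketAll]

theorem inner_map_ketMinus_right (x : H) (i : ℕ) :
    inner ℂ x (T (ketMinus m i)) =
      ((1 / √2 : ℝ) : ℂ) * (inner ℂ x (T (ket m 0)) - inner ℂ x (T (ket m i))) := by
  rw [map_ketMinus, inner_smul_right, inner_sub_right]

theorem inner_map_ketMinus_left (x : H) (i : ℕ) :
    inner ℂ (T (ketMinus m i)) x =
      ((1 / √2 : ℝ) : ℂ) * (inner ℂ (T (ket m 0)) x - inner ℂ (T (ket m i)) x) := by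
  rw [map_ketMinus, inner_smul_left, inner_sub_left, Complex.conj_ofReal]

/-- The images of distinct basis vectors are orthogonal. -/
def DiagonalOnKets : Prop :=
  ∀ i < m, ∀ j < m, i ≠ j → inner ℂ (T (ket m i)) (T (ket m j)) = (0 : ℂ)

variable {T}

theorem inner_map_ket_map_ketAll (hT : DiagonalOnKets T) {i : ℕ} (hi : i < m) :
    inner ℂ (T (ket m i)) (T (ketAll m)) =
      ((1 / √(m : ℝ) : ℝ) : ℂ) * inner ℂ (T (ket m i)) (T (ket m i)) := by
  rw [map_ketAll, inner_smul_right, inner_sum, Finset.sum_eq_single i]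
  · intro j hj hji
    exact hT i hi j (Finset.mem_range.1 hj) hji.symm
  · intro h; exact absurd (Finset.mem_range.2 hi) h

/-- With a diagonal Gram matrix, pairing against the image of the uniform vector reads off squared
norms up to a common factor, so the pairing with `|0 - i⟩` is a multiple of the difference of two of
them. -/
theorem inner_map_ket_self_eq_of_stopper (hT : DiagonalOnKets T) {i : ℕ} (hi : i < m)
    (h : inner ℂ (T (ketMinus m i)) (T (ketAll m)) = (0 : ℂ)) :
    inner ℂ (T (ket m i)) (T (ket m i)) = (inner ℂ (T (ket m 0)) (T (ket m 0)) : ℂ) := by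
  have hm : 0 < m := by omega
  rw [inner_map_ketMinus_left, inner_map_ket_map_ketAll hT hm, inner_map_ket_map_ketAll hT hi,
    ← mul_sub] at h
  have h1 := (mul_eq_zero.1 h).resolve_left one_div_sqrt_two_ne_zero
  have h2 := (mul_eq_zero.1 h1).resolve_left (one_div_sqrt_ne_zero hm)
  exact (sub_eq_zero.1 h2).symm

/-- A linear map that sends the basis vectors to orthogonal vectors of equal norm is a multiple of
an isometry. -/
theorem inner_map_map_eq_mul_inner (hT : DiagonalOnKets T)
    (h : ∀ i < m, inner ℂ (T (ket m i)) (T (ket m i)) =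
      (inner ℂ (T (ket m 0)) (T (ket m 0)) : ℂ)) (x y : LocalState m) :
    inner ℂ (T x) (T y) = (inner ℂ (T (ket m 0)) (T (ket m 0)) : ℂ) * inner ℂ x y := by
  rw [eq_sum_ket x, eq_sum_ket y]
  simp only [map_sum, map_smul, sum_inner, inner_sum, inner_smul_left, inner_smul_right,
    Finset.mul_sum]
  refine Finset.sum_congr rfl fun i _ => Finset.sum_congr rfl fun j _ => ?_
  rw [inner_ket_ket j.2]
  by_cases hij : (j : ℕ) = i
  · rw [hij, h _ i.2, if_pos rfl]; ring
  · rw [hT _ j.2 _ i.2 hij, if_neg hij]; ring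

end LinearImage

-- Overlaps of the local vectors

theorem diagonalOnKets_id (m : ℕ) : DiagonalOnKets (LinearMap.id : LocalState m →ₗ[ℂ] _) :=
  fun _ hi _ _ hij => inner_ket_ket_of_ne hi hij

theorem inner_ketMinus_left {m : ℕ} (v : LocalState m) (i : ℕ) :
    inner ℂ (ketMinus m i) v =
      ((1 / √2 : ℝ) : ℂ) * (inner ℂ (ket m 0) v - inner ℂ (ket m i) v) :=
  inner_map_ketMinus_left LinearMap.id v i

theorem inner_ketMinus_right {m : ℕ} (v : LocalState m) (i : ℕ) :
    inner ℂ v (ketMinus m i) =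
      ((1 / √2 : ℝ) : ℂ) * (inner ℂ v (ket m 0) - inner ℂ v (ket m i)) :=
  inner_map_ketMinus_right LinearMap.id v i

theorem inner_ketPlus_left {m : ℕ} (v : LocalState m) :
    inner ℂ (ketPlus m) v =
      ((1 / √2 : ℝ) : ℂ) * (inner ℂ (ket m 0) v + inner ℂ (ket m 1) v) := by
  rw [ketPlus, inner_smul_left, inner_add_left, Complex.conj_ofReal]

theorem inner_ket_ketAll {m i : ℕ} (hi : i < m) :
    inner ℂ (ket m i) (ketAll m) = ((1 / √(m : ℝ) : ℝ) : ℂ) := by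
  have := inner_map_ket_map_ketAll (diagonalOnKets_id m) hi
  simp only [LinearMap.id_apply] at this
  rw [this, inner_ket_ket hi, if_pos rfl, mul_one]

theorem ket_ne_zero {m i : ℕ} (hi : i < m) : ket m i ≠ 0 := by
  intro h
  have := inner_ket_ket (m := m) (i := i) (j := i) hi
  rw [h] at this; simp at this

theorem ne_zero_of_inner_ne_zero {m : ℕ} {v w : LocalState m} (h : (inner ℂ w v : ℂ) ≠ 0) :
    v ≠ 0 := by
  rintro rfl; simp at h

theorem inner_ket_ketMinus_self {m i : ℕ} (hi : i < m) (h0 : 1 ≤ i) :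
    inner ℂ (ket m i) (ketMinus m i) ≠ (0 : ℂ) := by
  rw [inner_ketMinus_right, inner_ket_ket hi, inner_ket_ket hi, if_neg (by omega), if_pos rfl]
  simp

theorem inner_ketMinus_ket_of_ne {m i j : ℕ} (hi : i < m) (hj : j ≠ 0) (hij : i ≠ j) :
    inner ℂ (ketMinus m i) (ket m j) = (0 : ℂ) := by
  rw [inner_ketMinus_left, inner_ket_ket hi, inner_ket_ket (by omega), if_neg (by omega),
    if_neg (by omega)]
  simp

/-- Both vectors contain `|0⟩`, and no cancellation occurs. Such overlaps on one factor are what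
moves an orthogonality constraint to the other factor. -/
theorem inner_ketMinus_ketMinus_ne_zero {m i j : ℕ} (hi : i < m) (hj : j < m) (h0 : 1 ≤ i)
    (h0' : 1 ≤ j) : inner ℂ (ketMinus m i) (ketMinus m j) ≠ (0 : ℂ) := by
  rw [inner_ketMinus_left, inner_ketMinus_right, inner_ketMinus_right, inner_ket_ket (by omega),
    inner_ket_ket (by omega), inner_ket_ket (by omega), inner_ket_ket (by omega), if_pos rfl,
    if_neg (by omega), if_neg (by omega)]
  have h := one_div_sqrt_two_ne_zero
  have h2 := mul_ne_zero h h
  split_ifs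
  · rw [← mul_sub, ← mul_assoc]
    exact mul_ne_zero h2 (by norm_num)
  · rw [← mul_sub, ← mul_assoc]
    exact mul_ne_zero h2 (by norm_num)

theorem inner_ketMinus_ketAll {m i : ℕ} (hi : i < m) :
    inner ℂ (ketMinus m i) (ketAll m) = (0 : ℂ) := by
  rw [inner_ketMinus_left, inner_ket_ketAll hi, inner_ket_ketAll (by omega)]; simp

theorem inner_ketPlus_ketMinus_one {m : ℕ} (hm : 2 ≤ m) :
    inner ℂ (ketPlus m) (ketMinus m 1) = (0 : ℂ) := by
  rw [inner_ketPlus_left, inner_ketMinus_right, inner_ketMinus_right, inner_ket_ket (by omega),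
    inner_ket_ket (by omega), inner_ket_ket (by omega), inner_ket_ket (by omega)]
  simp

theorem inner_ketPlus_ketAll_ne_zero {m : ℕ} (hm : 2 ≤ m) :
    inner ℂ (ketPlus m) (ketAll m) ≠ (0 : ℂ) := by
  rw [inner_ketPlus_left, inner_ket_ketAll (by omega), inner_ket_ketAll (by omega), ← two_mul]
  exact mul_ne_zero one_div_sqrt_two_ne_zero
    (mul_ne_zero two_ne_zero (one_div_sqrt_ne_zero (by omega)))

/-! ## Fourier vectors -/

theorem omega_isPrimitiveRoot {N : ℕ} (hN : N ≠ 0) : IsPrimitiveRoot (omega N) N :=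
  Complex.isPrimitiveRoot_exp N hN

theorem omega_conj {N : ℕ} : (starRingEnd ℂ) (omega N) = (omega N)⁻¹ := by
  have hn : ‖omega N‖ = 1 := by
    have : (2 * Real.pi * Complex.I / N : ℂ) = ((2 * Real.pi / N : ℝ) : ℂ) * Complex.I := by
      push_cast; ring
    rw [omega, this, Complex.norm_exp_ofReal_mul_I]
  rw [Complex.inv_def, Complex.normSq_eq_norm_sq, hn]; simp

/-- Orthogonality of the characters of `ℤ/N`. -/
theorem sum_omega_pow_mul_conj {N s t : ℕ} (hs : s < N) (ht : t < N) :
    ∑ r ∈ Finset.range N, omega N ^ (s * r) * (starRingEnd ℂ) (omega N ^ (t * r)) =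
      if s = t then (N : ℂ) else 0 := by
  have hN : N ≠ 0 := by omega
  have hω := omega_isPrimitiveRoot hN
  have h0 : omega N ≠ 0 := hω.ne_zero hN
  set z := omega N ^ s * (omega N ^ t)⁻¹ with hz
  have hterm : ∀ r, omega N ^ (s * r) * (starRingEnd ℂ) (omega N ^ (t * r)) = z ^ r := by
    intro r
    rw [map_pow, omega_conj, hz, mul_pow, pow_mul, pow_mul, ← inv_pow]
  simp only [hterm]
  split_ifs with hst
  · have : z = 1 := by rw [hz, hst]; exact mul_inv_cancel₀ (pow_ne_zero _ h0)
    simp [this]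
  · have hz1 : z ≠ 1 := by
      intro h
      have := (mul_inv_eq_one₀ (pow_ne_zero t h0)).1 (hz ▸ h)
      exact hst (hω.pow_inj hs ht this)
    have hzN : z ^ N = 1 := by
      rw [hz, mul_pow, inv_pow, ← pow_mul, ← pow_mul, mul_comm s, mul_comm t, pow_mul, pow_mul,
        hω.pow_eq_one]
      simp
    have := geom_sum_eq hz1 N
    rw [this, hzN]; simp

/-- A function on `ℤ/N` all of whose nontrivial Fourier coefficients vanish is constant. -/
theorem eq_of_fourier_eq_zero {N : ℕ} (g : ℕ → ℂ)
    (h : ∀ s, 1 ≤ s → s < N →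
      ∑ t ∈ Finset.range N, (starRingEnd ℂ) (omega N ^ (s * t)) * g t = 0)
    {r : ℕ} (hr : r < N) : g r = g 0 := by
  have key : ∀ r < N, (N : ℂ) * g r = ∑ t ∈ Finset.range N, g t := by
    intro r hr
    -- Fourier inversion at `r`: only the coefficient `s = 0` survives, and it does not depend on
    -- `r`.
    have h1 : ∑ s ∈ Finset.range N, omega N ^ (r * s) *
        ∑ t ∈ Finset.range N, (starRingEnd ℂ) (omega N ^ (s * t)) * g t =
        ∑ t ∈ Finset.range N, g t := by
      rw [Finset.sum_eq_single 0]
      · simp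
      · intro s hs hs0
        rw [h s (by omega) (Finset.mem_range.1 hs), mul_zero]
      · intro h; exact absurd (Finset.mem_range.2 (by omega)) h
    rw [← h1]
    simp only [Finset.mul_sum]
    rw [Finset.sum_comm]
    have h2 : ∀ t ∈ Finset.range N, ∑ s ∈ Finset.range N, omega N ^ (r * s) *
        ((starRingEnd ℂ) (omega N ^ (s * t)) * g t) = if r = t then (N : ℂ) * g t else 0 := by
      intro t ht
      have := sum_omega_pow_mul_conj hr (Finset.mem_range.1 ht)
      rw [← zero_mul (g t), ← ite_mul, ← this, Finset.sum_mul]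
      refine Finset.sum_congr rfl fun s _ => ?_
      rw [mul_comm s t, mul_assoc]
    rw [Finset.sum_congr rfl h2]
    simp [hr]
  have hN : (N : ℂ) ≠ 0 := by exact_mod_cast (by omega : N ≠ 0)
  exact mul_left_cancel₀ hN ((key r hr).trans (key 0 (by omega)).symm)

/-- The basis labels that occur in `ketFourier`: `2, m₁, m₁ + 1, …, m₂ - 1`. -/
def fourierLabel (m₁ t : ℕ) : ℕ := if t = 0 then 2 else t + m₁ - 1

theorem fourierLabel_lt {m₁ m₂ t : ℕ} (h : 3 ≤ m₁) (h' : m₁ ≤ m₂) (ht : t < m₂ - m₁ + 1) :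
    fourierLabel m₁ t < m₂ := by
  unfold fourierLabel; split_ifs <;> omega

theorem fourierLabel_injective {m₁ : ℕ} (h : 3 ≤ m₁) : Function.Injective (fourierLabel m₁) := by
  intro s t hst
  unfold fourierLabel at hst; split_ifs at hst <;> omega

/-- Giving `|2⟩` the index `t = 0` makes the coefficients a full character of `ℤ/N` with `N = m₂ -
m₁ + 1`, so that character orthogonality applies. -/
theorem ketFourier_eq (m₁ m₂ s : ℕ) :
    ketFourier m₁ m₂ s = ∑ t ∈ Finset.range (m₂ - m₁ + 1),
      omega (m₂ - m₁ + 1) ^ (s * t) • ket m₂ (fourierLabel m₁ t) := by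
  rw [Finset.range_eq_Ico, Finset.sum_eq_sum_Ico_succ_bot (by omega), ketFourier]
  congr 1
  · simp [fourierLabel]
  · refine Finset.sum_congr ?_ fun t ht => ?_
    · ext t; simp
    · rw [fourierLabel, if_neg (by simp at ht; omega)]

theorem inner_map_ketFourier_left {m₁ m₂ : ℕ} {H : Type*} [NormedAddCommGroup H]
    [InnerProductSpace ℂ H] (T : LocalState m₂ →ₗ[ℂ] H) (s : ℕ) (x : H) :
    inner ℂ (T (ketFourier m₁ m₂ s)) x = ∑ t ∈ Finset.range (m₂ - m₁ + 1),
      (starRingEnd ℂ) (omega (m₂ - m₁ + 1) ^ (s * t)) *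
        inner ℂ (T (ket m₂ (fourierLabel m₁ t))) x := by
  simp only [ketFourier_eq, map_sum, map_smul, sum_inner, inner_smul_left]

theorem inner_ketFourier_left {m₁ m₂ : ℕ} (s : ℕ) (x : LocalState m₂) :
    inner ℂ (ketFourier m₁ m₂ s) x = ∑ t ∈ Finset.range (m₂ - m₁ + 1),
      (starRingEnd ℂ) (omega (m₂ - m₁ + 1) ^ (s * t)) *
        inner ℂ (ket m₂ (fourierLabel m₁ t)) x :=
  inner_map_ketFourier_left LinearMap.id s x

theorem inner_ketFourier_ket {m₁ m₂ s j : ℕ} (h : 3 ≤ m₁) (h' : m₁ ≤ m₂)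
    (hj : j ≠ 2) (hj' : j < m₁) : inner ℂ (ketFourier m₁ m₂ s) (ket m₂ j) = (0 : ℂ) := by
  rw [inner_ketFourier_left]
  refine Finset.sum_eq_zero fun t ht => ?_
  rw [inner_ket_ket_of_ne (fourierLabel_lt h h' (Finset.mem_range.1 ht)), mul_zero]
  unfold fourierLabel; split_ifs <;> omega

theorem inner_ket_two_ketFourier {m₁ m₂ : ℕ} (s : ℕ) (h : 3 ≤ m₁) (h' : m₁ ≤ m₂) :
    inner ℂ (ket m₂ 2) (ketFourier m₁ m₂ s) = (1 : ℂ) := by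
  rw [ketFourier, inner_add_right, inner_ket_ket (by omega), if_pos rfl, inner_sum,
    Finset.sum_eq_zero, add_zero]
  intro t ht
  rw [inner_smul_right, inner_ket_ket_of_ne (by omega), mul_zero]
  simp at ht; omega

theorem inner_ketFourier_ketAll {m₁ m₂ s : ℕ} (h : 3 ≤ m₁) (h' : m₁ ≤ m₂) (hs : 1 ≤ s)
    (hs' : s ≤ m₂ - m₁) : inner ℂ (ketFourier m₁ m₂ s) (ketAll m₂) = (0 : ℂ) := by
  have key := sum_omega_pow_mul_conj (N := m₂ - m₁ + 1) (s := 0) (t := s) (by omega) (by omega)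
  rw [if_neg (by omega)] at key
  rw [inner_ketFourier_left]
  rw [← zero_mul (((1 / √(m₂ : ℝ) : ℝ) : ℂ)), ← key, Finset.sum_mul]
  refine Finset.sum_congr rfl fun t ht => ?_
  rw [inner_ket_ketAll (fourierLabel_lt h h' (Finset.mem_range.1 ht))]
  simp

theorem inner_ketFourier_ketFourier {m₁ m₂ s s' : ℕ} (h : 3 ≤ m₁) (h' : m₁ ≤ m₂)
    (hs : s ≤ m₂ - m₁) (hs' : s' ≤ m₂ - m₁) (hne : s ≠ s') :
    inner ℂ (ketFourier m₁ m₂ s) (ketFourier m₁ m₂ s') = (0 : ℂ) := by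
  have key := sum_omega_pow_mul_conj (N := m₂ - m₁ + 1) (s := s') (t := s) (by omega) (by omega)
  rw [if_neg (by omega)] at key
  rw [inner_ketFourier_left, ← key]
  refine Finset.sum_congr rfl fun t ht => ?_
  rw [mul_comm, ketFourier_eq, inner_sum, Finset.sum_eq_single t]
  · rw [inner_smul_right, inner_ket_ket (fourierLabel_lt h h' (Finset.mem_range.1 ht)), if_pos rfl,
      mul_one]
  · intro r _ hrt
    rw [inner_smul_right, inner_ket_ket_of_ne (fourierLabel_lt h h' (Finset.mem_range.1 ht)),
      mul_zero]
    exact fun h' => hrt (fourierLabel_injective h h').symm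
  · intro h; exact absurd ht h

/-! ## The bipartite set -/

section Rigidity

variable {p q : ℕ} {H : Type*} [NormedAddCommGroup H] [InnerProductSpace ℂ H]

/-- A linear map on the first factor that preserves the orthogonality of the bipartite set is a
multiple of an isometry. -/
theorem exists_inner_map_map_eq_left (hp : 3 ≤ p) (hpq : p ≤ q) (T : LocalState p →ₗ[ℂ] H)
    (hT : ∀ x y x' y', BipartitePair p q x y → BipartitePair p q x' y' →
      inner ℂ x x' = (0 : ℂ) → inner ℂ y y' ≠ (0 : ℂ) → inner ℂ (T x) (T x') = (0 : ℂ)) :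
    ∃ c : ℂ, ∀ x x', inner ℂ (T x) (T x') = c * inner ℂ x x' := by
  -- The states `|i⟩|0-i⟩` and `|j⟩|0-j⟩` overlap on the second factor through `|0⟩`.
  have hpos : ∀ i < p, 1 ≤ i → ∀ j < p, 1 ≤ j → i ≠ j →
      inner ℂ (T (ket p i)) (T (ket p j)) = (0 : ℂ) := fun i hi hi1 j hj hj1 hij =>
    hT _ _ _ _ (.left i hi1 (by omega)) (.left j hj1 (by omega)) (inner_ket_ket_of_ne hi hij)
      (inner_ketMinus_ketMinus_ne_zero (by omega) (by omega) hi1 hj1)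
  have hzero : ∀ i j, i < p → 1 ≤ i → j < p → 1 ≤ j → i ≠ j →
      inner ℂ (T (ketMinus p j)) (T (ket p i)) = (0 : ℂ) →
      inner ℂ (T (ket p 0)) (T (ket p i)) = (0 : ℂ) := by
    intro i j hi hi1 hj hj1 hij h
    rw [inner_map_ketMinus_left, hpos j hj hj1 i hi hi1 hij.symm, sub_zero] at h
    exact (mul_eq_zero.1 h).resolve_left one_div_sqrt_two_ne_zero
  -- Each `|i⟩` on the second factor is paired with some `|0-j⟩`, `j ≠ i`, and overlaps `|0-i⟩`
  -- there. So `T|0-j⟩ ⊥ T|i⟩`, and the `|j⟩` part is already known to vanish. For `i = 1` the index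
  -- wraps around to `j = p - 1`, which differs from `1` because `3 ≤ p`.
  have h0 : ∀ i < p, 1 ≤ i → inner ℂ (T (ket p 0)) (T (ket p i)) = (0 : ℂ) := by
    intro i hi hi1
    rcases Nat.eq_or_lt_of_le hi1 with rfl | h2
    · refine hzero 1 (p - 1) hi hi1 (by omega) (by omega) (by omega) ?_
      refine hT _ _ _ _ .rightLast (.left 1 le_rfl (by omega))
        (inner_ketMinus_ket_of_ne (by omega) (by omega) (by omega))
        (inner_ket_ketMinus_self (by omega) le_rfl)
    · obtain ⟨j, rfl⟩ : ∃ j, i = j + 1 := ⟨i - 1, by omega⟩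
      refine hzero (j + 1) j hi hi1 (by omega) (by omega) (by omega) ?_
      exact hT _ _ _ _ (.right j (by omega) (by omega)) (.left (j + 1) hi1 (by omega))
        (inner_ketMinus_ket_of_ne (by omega) (by omega) (by omega))
        (inner_ket_ketMinus_self (by omega) hi1)
  have hdiag : DiagonalOnKets T := by
    intro i hi j hj hij
    rcases Nat.eq_zero_or_pos i with rfl | hi0
    · exact h0 j hj (by omega)
    rcases Nat.eq_zero_or_pos j with rfl | hj0
    · exact inner_eq_zero_symm.1 (h0 i hi hi0)
    · exact hpos i hi hi0 j hj hj0 hij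
  refine ⟨_, inner_map_map_eq_mul_inner hdiag fun i hi => ?_⟩
  rcases Nat.eq_zero_or_pos i with rfl | hi0
  · rfl
  refine inner_map_ket_self_eq_of_stopper hdiag hi ?_
  -- Every `|0-i⟩` occurs as a first factor, beside a basis vector that overlaps the stopper.
  by_cases h : i ≤ p - 2
  · refine hT _ _ _ _ (.right i hi0 h) .stopper (inner_ketMinus_ketAll hi) ?_
    rw [inner_ket_ketAll (by omega)]
    exact one_div_sqrt_ne_zero (by omega)
  · obtain rfl : i = p - 1 := by omega
    refine hT _ _ _ _ .rightLast .stopper (inner_ketMinus_ketAll hi) ?_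
    rw [inner_ket_ketAll (by omega)]
    exact one_div_sqrt_ne_zero (by omega)

/-- Every basis vector except `|0⟩` occurs in the second factor, with a first factor `|0 - i⟩`. -/
theorem exists_bipartitePair_ketMinus_ket (hp : 3 ≤ p) {j : ℕ} (hj : 1 ≤ j) (hjq : j < q) :
    ∃ i, 1 ≤ i ∧ i < p ∧ i ≠ j ∧ BipartitePair p q (ketMinus p i) (ket q j) := by
  rcases Nat.eq_or_lt_of_le hj with rfl | h2
  · exact ⟨p - 1, by omega, by omega, by omega, .rightLast⟩
  by_cases hjp : j < p
  · obtain ⟨i, rfl⟩ : ∃ i, j = i + 1 := ⟨j - 1, by omega⟩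
    exact ⟨i, by omega, by omega, by omega, .right i (by omega) (by omega)⟩
  · exact ⟨1, le_rfl, by omega, by omega, .extra j (by omega) (by omega)⟩

/-- A linear map on the second factor that preserves the orthogonality of the bipartite set is a
multiple of an isometry. -/
theorem exists_inner_map_map_eq_right (hp : 3 ≤ p) (hpq : p ≤ q) (T : LocalState q →ₗ[ℂ] H)
    (hT : ∀ x y x' y', BipartitePair p q x y → BipartitePair p q x' y' →
      inner ℂ y y' = (0 : ℂ) → inner ℂ x x' ≠ (0 : ℂ) → inner ℂ (T y) (T y') = (0 : ℂ)) :
    ∃ c : ℂ, ∀ y y', inner ℂ (T y) (T y') = c * inner ℂ y y' := by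
  have hpos : ∀ i < q, 1 ≤ i → ∀ j < q, 1 ≤ j → i ≠ j →
      inner ℂ (T (ket q i)) (T (ket q j)) = (0 : ℂ) := by
    intro i hi hi1 j hj hj1 hij
    -- The two first factors are of the form `|0-k⟩` and `|0-l⟩`, which overlap even when `k = l`.
    obtain ⟨k, hk1, hkp, -, hk⟩ := exists_bipartitePair_ketMinus_ket hp hi1 hi
    obtain ⟨l, hl1, hlp, -, hl⟩ := exists_bipartitePair_ketMinus_ket hp hj1 hj
    exact hT _ _ _ _ hk hl (inner_ket_ket_of_ne hi hij)
      (inner_ketMinus_ketMinus_ne_zero hkp hlp hk1 hl1)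
  have h0 : ∀ j < q, 1 ≤ j → inner ℂ (T (ket q 0)) (T (ket q j)) = (0 : ℂ) := by
    intro j hj hj1
    obtain ⟨i, hi1, hip, hij, hi⟩ := exists_bipartitePair_ketMinus_ket hp hj1 hj
    -- Compares `|i⟩|0-i⟩` with `|0-i⟩|j⟩`: the first factors overlap, and `i ≠ j` makes the second
    -- ones orthogonal.
    have h := hT _ _ _ _ (.left i hi1 (by omega)) hi
      (inner_ketMinus_ket_of_ne (by omega) (by omega) hij) (inner_ket_ketMinus_self hip hi1)
    rw [inner_map_ketMinus_left, hpos i (by omega) hi1 j hj hj1 hij, sub_zero] at h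
    exact (mul_eq_zero.1 h).resolve_left one_div_sqrt_two_ne_zero
  have hdiag : DiagonalOnKets T := by
    intro i hi j hj hij
    rcases Nat.eq_zero_or_pos i with rfl | hi0
    · exact h0 j hj (by omega)
    rcases Nat.eq_zero_or_pos j with rfl | hj0
    · exact inner_eq_zero_symm.1 (h0 i hi hi0)
    · exact hpos i hi hi0 j hj hj0 hij
  have hlow : ∀ i < p, inner ℂ (T (ket q i)) (T (ket q i)) =
      (inner ℂ (T (ket q 0)) (T (ket q 0)) : ℂ) := by
    intro i hi
    rcases Nat.eq_zero_or_pos i with rfl | hi0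
    · rfl
    refine inner_map_ket_self_eq_of_stopper hdiag (by omega) ?_
    refine hT _ _ _ _ (.left i hi0 (by omega)) .stopper (inner_ketMinus_ketAll (by omega)) ?_
    rw [inner_ket_ketAll hi]
    exact one_div_sqrt_ne_zero (by omega)
  refine ⟨_, inner_map_map_eq_mul_inner hdiag fun i hi => ?_⟩
  by_cases hip : i < p
  · exact hlow i hip
  -- The labels `i ≥ p` are out of reach of the vectors `|0-i⟩`. The squared norms on `2, p, …, q-1`
  -- form a function on `ℤ/N` whose nontrivial Fourier coefficients vanish by the Fourier states
  -- against the stopper. It is therefore constant, and the label `2 < p` ties it to the norm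
  -- already found.
  have hF := eq_of_fourier_eq_zero (N := q - p + 1) (r := i - p + 1)
    (fun t => inner ℂ (T (ket q (fourierLabel p t))) (T (ket q (fourierLabel p t)))) ?_ (by omega)
  · have h1 : fourierLabel p (i - p + 1) = i := by
      rw [fourierLabel, if_neg (by omega)]; omega
    have h2 : fourierLabel p 0 = 2 := by rw [fourierLabel, if_pos rfl]
    simp only [h1, h2] at hF
    exact hF.trans (hlow 2 (by omega))
  · intro s hs hs'
    have h := hT _ _ _ _ (.fourier s hs (by omega)) .stopper
      (inner_ketFourier_ketAll hp hpq hs (by omega)) (inner_ketPlus_ketAll_ne_zero (by omega))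
    rw [inner_map_ketFourier_left] at h
    have hq : ((1 / √(q : ℝ) : ℝ) : ℂ) ≠ 0 := one_div_sqrt_ne_zero (by omega)
    refine (mul_eq_zero.1 (?_ : ((1 / √(q : ℝ) : ℝ) : ℂ) * _ = 0)).resolve_left hq
    rw [← h, Finset.mul_sum]
    refine Finset.sum_congr rfl fun t ht => ?_
    rw [inner_map_ket_map_ketAll hdiag (fourierLabel_lt hp hpq (Finset.mem_range.1 ht))]
    ring

end Rigidity

/-- Labels for the elements of the bipartite set. -/
abbrev PairIndex (p q : ℕ) : Type :=
  Fin (p - 1) ⊕ Fin (p - 2) ⊕ Unit ⊕ Fin (q - p) ⊕ Fin (q - p) ⊕ Unit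

/-- The element of the bipartite set with a given label. -/
def pairVec (p q : ℕ) : PairIndex p q → LocalState p × LocalState q
  | .inl i => (ket p (i + 1), ketMinus q (i + 1))
  | .inr (.inl i) => (ketMinus p (i + 1), ket q (i + 1 + 1))
  | .inr (.inr (.inl _)) => (ketMinus p (p - 1), ket q 1)
  | .inr (.inr (.inr (.inl j))) => (ketMinus p 1, ket q (p + j))
  | .inr (.inr (.inr (.inr (.inl s)))) => (ketPlus p, ketFourier p q (s + 1))
  | .inr (.inr (.inr (.inr (.inr _)))) => (ketAll p, ketAll q)

theorem card_pairIndex {p q : ℕ} (hp : 3 ≤ p) (hpq : p ≤ q) :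
    Fintype.card (PairIndex p q) = 2 * q - 1 := by
  simp only [Fintype.card_sum, Fintype.card_fin, Fintype.card_unit]
  omega

theorem bipartitePair_iff {p q : ℕ} (hp : 3 ≤ p) (x : LocalState p)
    (y : LocalState q) : BipartitePair p q x y ↔ ∃ s, pairVec p q s = (x, y) := by
  constructor
  · rintro (⟨i, h₁, h₂⟩ | ⟨i, h₁, h₂⟩ | _ | ⟨j, h₁, h₂⟩ | ⟨s, h₁, h₂⟩ | _)
    · exact ⟨.inl ⟨i - 1, by omega⟩, by simp [pairVec, Nat.sub_add_cancel h₁]⟩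
    · exact ⟨.inr (.inl ⟨i - 1, by omega⟩), by simp [pairVec, Nat.sub_add_cancel h₁]⟩
    · exact ⟨.inr (.inr (.inl ())), rfl⟩
    · exact ⟨.inr (.inr (.inr (.inl ⟨j - p, by omega⟩))), by
        simp [pairVec, Nat.add_sub_cancel' h₁]⟩
    · exact ⟨.inr (.inr (.inr (.inr (.inl ⟨s - 1, by omega⟩)))), by
        simp [pairVec, Nat.sub_add_cancel h₁]⟩
    · exact ⟨.inr (.inr (.inr (.inr (.inr ())))), rfl⟩
  · rintro ⟨i | i | i | i | i | i, h⟩ <;> obtain ⟨rfl, rfl⟩ := Prod.mk.inj h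
    · exact .left _ (by omega) (by omega)
    · exact .right _ (by omega) (by omega)
    · exact .rightLast
    · exact .extra _ (by omega) (by omega)
    · exact .fourier _ (by omega) (by omega)
    · exact .stopper

theorem bipartitePair_ne_zero {p q : ℕ} (hp : 3 ≤ p) (hpq : p ≤ q) {x : LocalState p}
    {y : LocalState q} (h : BipartitePair p q x y) : x ≠ 0 ∧ y ≠ 0 := by
  have hminus : ∀ {m i : ℕ}, i < m → 1 ≤ i → ketMinus m i ≠ 0 := fun hi h1 =>
    ne_zero_of_inner_ne_zero (inner_ket_ketMinus_self hi h1)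
  have hall : ∀ {m : ℕ}, 0 < m → ketAll m ≠ 0 := fun {m} hm =>
    ne_zero_of_inner_ne_zero (w := ket m 0) (by
      rw [inner_ket_ketAll hm]; exact one_div_sqrt_ne_zero hm)
  rcases h with (⟨i, h₁, h₂⟩ | ⟨i, h₁, h₂⟩ | _ | ⟨j, h₁, h₂⟩ | ⟨s, h₁, h₂⟩ | _)
  · exact ⟨ket_ne_zero (by omega), hminus (by omega) h₁⟩
  · exact ⟨hminus (by omega) h₁, ket_ne_zero (by omega)⟩
  · exact ⟨hminus (by omega) (by omega), ket_ne_zero (by omega)⟩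
  · exact ⟨hminus (by omega) le_rfl, ket_ne_zero (by omega)⟩
  · refine ⟨fun h0 => inner_ketPlus_ketAll_ne_zero (m := p) (by omega) (by rw [h0]; simp), ?_⟩
    refine ne_zero_of_inner_ne_zero (w := ket q 2) ?_
    rw [inner_ket_two_ketFourier s hp hpq]; exact one_ne_zero
  · exact ⟨hall (by omega), hall (by omega)⟩

/-- The product vectors `u.1 ⊗ u.2` and `v.1 ⊗ v.2` are orthogonal. -/
def OrthogonalPair {p q : ℕ} (u v : LocalState p × LocalState q) : Prop :=
  inner ℂ u.1 v.1 = (0 : ℂ) ∨ inner ℂ u.2 v.2 = (0 : ℂ)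

theorem OrthogonalPair.symm {p q : ℕ} {u v : LocalState p × LocalState q}
    (h : OrthogonalPair u v) : OrthogonalPair v u :=
  h.imp inner_eq_zero_symm.1 inner_eq_zero_symm.1

/-- The elements of the bipartite set are mutually orthogonal. -/
theorem pairVec_orthogonal {p q : ℕ} (hp : 3 ≤ p) (hpq : p ≤ q) {s t : PairIndex p q}
    (hst : s ≠ t) : OrthogonalPair (pairVec p q s) (pairVec p q t) := by
  have kk : ∀ {m i j : ℕ}, i < m → i ≠ j → inner ℂ (ket m i) (ket m j) = (0 : ℂ) :=
    inner_ket_ket_of_ne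
  have km : ∀ {m i j : ℕ}, j < m → i ≠ 0 → j ≠ i → inner ℂ (ket m i) (ketMinus m j) = (0 : ℂ) :=
    fun h h' h'' => inner_eq_zero_symm.1 (inner_ketMinus_ket_of_ne h h' h'')
  have kF : ∀ {j : ℕ} (s : ℕ), j ≠ 2 → j < p → inner ℂ (ket q j) (ketFourier p q s) = (0 : ℂ) :=
    fun s h h' => inner_eq_zero_symm.1 (inner_ketFourier_ket hp hpq h h')
  have pm : inner ℂ (ketMinus p 1) (ketPlus p) = (0 : ℂ) :=
    inner_eq_zero_symm.1 (inner_ketPlus_ketMinus_one (by omega))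
  have mA : ∀ {m i : ℕ}, i < m → inner ℂ (ketMinus m i) (ketAll m) = (0 : ℂ) :=
    inner_ketMinus_ketAll
  -- In the names `hab` below, `a` and `b` number the six families of `pairVec`. A case split on the
  -- index occurs where neither factor alone is always orthogonal.
  have h12 : ∀ i j, OrthogonalPair (pairVec p q (.inl i)) (pairVec p q (.inr (.inl j))) := by
    intro i j
    by_cases h : (j : ℕ) = i
    · exact .inr (inner_ketMinus_ket_of_ne (by omega) (by omega) (by omega))
    · exact .inl (km (by omega) (by omega) (by omega))
  have h13 : ∀ i j, OrthogonalPair (pairVec p q (.inl i)) (pairVec p q (.inr (.inr (.inl j)))) := by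
    intro i j
    by_cases h : (i : ℕ) = 0
    · exact .inl (km (by omega) (by omega) (by omega))
    · exact .inr (inner_ketMinus_ket_of_ne (by omega) (by omega) (by omega))
  have h14 : ∀ i j, OrthogonalPair (pairVec p q (.inl i))
      (pairVec p q (.inr (.inr (.inr (.inl j))))) := fun i j =>
    .inr (inner_ketMinus_ket_of_ne (by omega) (by omega) (by omega))
  have h15 : ∀ i j, OrthogonalPair (pairVec p q (.inl i))
      (pairVec p q (.inr (.inr (.inr (.inr (.inl j)))))) := by
    intro i j
    by_cases h : (i : ℕ) = 0
    · refine .inr ?_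
      simp only [pairVec, h]
      rw [inner_ketMinus_left, kF _ (by omega) (by omega), kF _ (by omega) (by omega)]
      simp
    · refine .inl ?_
      simp only [pairVec]
      rw [← inner_eq_zero_symm, inner_ketPlus_left, kk (by omega) (by omega),
        kk (by omega) (by omega)]
      simp
  have h16 : ∀ i j, OrthogonalPair (pairVec p q (.inl i))
      (pairVec p q (.inr (.inr (.inr (.inr (.inr j)))))) := fun i j => .inr (mA (by omega))
  have h23 : ∀ i j, OrthogonalPair (pairVec p q (.inr (.inl i)))
      (pairVec p q (.inr (.inr (.inl j)))) := fun i j => .inr (kk (by omega) (by omega))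
  have h24 : ∀ i j, OrthogonalPair (pairVec p q (.inr (.inl i)))
      (pairVec p q (.inr (.inr (.inr (.inl j))))) := fun i j => .inr (kk (by omega) (by omega))
  have h25 : ∀ i j, OrthogonalPair (pairVec p q (.inr (.inl i)))
      (pairVec p q (.inr (.inr (.inr (.inr (.inl j)))))) := by
    intro i j
    -- For `i = 0` the second factor is `|2⟩`, which overlaps the Fourier vector, so `|0-1⟩ ⊥ |0+1⟩`
    -- has to serve.
    by_cases h : (i : ℕ) = 0
    · refine .inl ?_
      simp only [pairVec, h]
      exact pm
    · exact .inr (kF _ (by omega) (by omega))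
  have h26 : ∀ i j, OrthogonalPair (pairVec p q (.inr (.inl i)))
      (pairVec p q (.inr (.inr (.inr (.inr (.inr j)))))) := fun i j => .inl (mA (by omega))
  have h34 : ∀ i j, OrthogonalPair (pairVec p q (.inr (.inr (.inl i))))
      (pairVec p q (.inr (.inr (.inr (.inl j))))) := fun i j => .inr (kk (by omega) (by omega))
  have h35 : ∀ i j, OrthogonalPair (pairVec p q (.inr (.inr (.inl i))))
      (pairVec p q (.inr (.inr (.inr (.inr (.inl j)))))) :=
    fun i j => .inr (kF _ (by omega) (by omega))
  have h36 : ∀ i j, OrthogonalPair (pairVec p q (.inr (.inr (.inl i))))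
      (pairVec p q (.inr (.inr (.inr (.inr (.inr j)))))) := fun i j => .inl (mA (by omega))
  have h45 : ∀ i j, OrthogonalPair (pairVec p q (.inr (.inr (.inr (.inl i)))))
      (pairVec p q (.inr (.inr (.inr (.inr (.inl j)))))) := fun i j => .inl pm
  have h46 : ∀ i j, OrthogonalPair (pairVec p q (.inr (.inr (.inr (.inl i)))))
      (pairVec p q (.inr (.inr (.inr (.inr (.inr j)))))) := fun i j => .inl (mA (by omega))
  have h56 : ∀ i j, OrthogonalPair (pairVec p q (.inr (.inr (.inr (.inr (.inl i))))))
      (pairVec p q (.inr (.inr (.inr (.inr (.inr j)))))) := fun i j =>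
    .inr (inner_ketFourier_ketAll hp hpq (by omega) (by omega))
  rcases s with i | i | i | i | i | i <;> rcases t with j | j | j | j | j | j
  all_goals first
    | exact absurd rfl hst
    | with_reducible first
      | apply h12 | apply h13 | apply h14 | apply h15 | apply h16 | apply h23 | apply h24
      | apply h25 | apply h26 | apply h34 | apply h35 | apply h36 | apply h45 | apply h46 | apply h56
    | apply OrthogonalPair.symm
      with_reducible first
      | apply h12 | apply h13 | apply h14 | apply h15 | apply h16 | apply h23 | apply h24
      | apply h25 | apply h26 | apply h34 | apply h35 | apply h36 | apply h45 | apply h46 | apply h56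
    | skip
  -- What remains is two different members of the same family, for the four families with more than
  -- one label in general.
  all_goals simp only [ne_eq, Sum.inl.injEq, Sum.inr.injEq, Fin.ext_iff] at hst
  · exact .inl (kk (by omega) (by omega))
  · exact .inr (kk (by omega) (by omega))
  · exact .inr (kk (by omega) (by omega))
  · exact .inr (inner_ketFourier_ketFourier hp hpq (by omega) (by omega) (by omega))

/-! ## Two groups of parties -/

section Combine

variable {n : ℕ} {d : Fin n → ℕ}

theorem sum_prod_conj_mul_prod {ι : Type*} [Fintype ι] [DecidableEq ι] {m : ι → ℕ}
    (v w : (i : ι) → LocalState (m i)) :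
    ∑ x : (i : ι) → Fin (m i), (∏ i, w i (x i)) * (starRingEnd ℂ) (∏ i, v i (x i)) =
      ∏ i, inner ℂ (v i) (w i) := by
  simp only [PiLp.inner_apply, map_prod, ← Finset.prod_mul_distrib]
  rw [Finset.prod_univ_sum, Fintype.piFinset_univ]
  rfl

theorem inner_productVector (v w : (i : Fin n) → LocalState (d i)) :
    inner ℂ (productVector v) (productVector w) = ∏ i, (inner ℂ (v i) (w i) : ℂ) := by
  rw [← sum_prod_conj_mul_prod, PiLp.inner_apply]
  rfl

/-- The joint space of the parties in `L`. -/
abbrev LabState (d : Fin n → ℕ) (L : Finset (Fin n)) : Type := EuclideanSpace ℂ (LabBasis d L)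

/-- The tensor product of the local vectors of the parties in `L`. -/
def labProduct (L : Finset (Fin n)) (v : (i : Fin n) → LocalState (d i)) : LabState d L :=
  WithLp.toLp 2 fun c => ∏ i : L, v i (c i)

theorem inner_labProduct (L : Finset (Fin n)) (v w : (i : Fin n) → LocalState (d i)) :
    inner ℂ (labProduct L v) (labProduct L w) = ∏ i : L, (inner ℂ (v i) (w i) : ℂ) := by
  rw [← sum_prod_conj_mul_prod (fun i : L => v i) (fun i : L => w i), PiLp.inner_apply]
  rfl

/-- The tensor product of a state of the parties in `L` and a state of the other parties. -/
def combine {L : Finset (Fin n)} (f : LabState d L) (g : LabState d Lᶜ) : MultiState d :=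
  WithLp.toLp 2 fun x => f (fun i => x i) * g (fun i => x i)

/-- Splitting a basis label into the labels of two groups of parties. -/
def labEquiv (d : Fin n → ℕ) (L : Finset (Fin n)) :
    ((i : Fin n) → Fin (d i)) ≃ LabBasis d L × LabBasis d Lᶜ where
  toFun x := (fun i => x i, fun i => x i)
  invFun c i := if h : i ∈ L then c.1 ⟨i, h⟩ else c.2 ⟨i, Finset.mem_compl.2 h⟩
  left_inv x := by ext i; by_cases h : i ∈ L <;> simp [h]
  right_inv c := by
    ext i
    · simp [i.2]
    · simp [Finset.mem_compl.1 i.2]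

theorem inner_combine {L : Finset (Fin n)} (f f' : LabState d L) (g g' : LabState d Lᶜ) :
    inner ℂ (combine f g) (combine f' g') = (inner ℂ f f' * inner ℂ g g' : ℂ) := by
  simp only [PiLp.inner_apply]
  rw [Finset.sum_mul_sum, ← Fintype.sum_prod_type', ← (labEquiv d L).sum_comp]
  refine Finset.sum_congr rfl fun x _ => ?_
  simp only [combine, labEquiv, RCLike.inner_apply, Equiv.coe_fn_mk, map_mul]
  ring

theorem productVector_eq_combine (L : Finset (Fin n)) (v : (i : Fin n) → LocalState (d i)) :
    productVector v = combine (labProduct L v) (labProduct Lᶜ v) := by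
  ext x
  simp only [productVector, combine, labProduct]
  rw [← Finset.prod_mul_prod_compl L]
  congr 1
  · exact (Finset.prod_coe_sort L fun i => v i (x i)).symm
  · exact (Finset.prod_coe_sort Lᶜ fun i => v i (x i)).symm

theorem applyLocal_combine {L : Finset (Fin n)} (M : Matrix (LabBasis d L) (LabBasis d L) ℂ)
    (f : LabState d L) (g : LabState d Lᶜ) :
    applyLocal L M (combine f g) = combine (Matrix.toEuclideanLin M f) g := by
  ext x
  simp only [applyLocal, combine, Matrix.toLpLin_apply, Matrix.mulVec, dotProduct,
    Finset.sum_mul]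
  refine Finset.sum_congr rfl fun a _ => ?_
  have h1 : (fun i : L => if h : (i : Fin n) ∈ L then a ⟨i, h⟩ else x i) = a := by
    ext i; simp [i.2]
  have h2 : (fun i : (Lᶜ : Finset (Fin n)) => if h : (i : Fin n) ∈ L then a ⟨i, h⟩ else x i) =
      fun i : (Lᶜ : Finset (Fin n)) => x i := by
    ext i; simp [Finset.mem_compl.1 i.2]
  rw [h1, h2, mul_assoc]

theorem applyLocal_compl_combine {L : Finset (Fin n)}
    (N : Matrix (LabBasis d Lᶜ) (LabBasis d Lᶜ) ℂ) (f : LabState d L) (g : LabState d Lᶜ) :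
    applyLocal Lᶜ N (combine f g) = combine f (Matrix.toEuclideanLin N g) := by
  ext x
  simp only [applyLocal, combine, Matrix.toLpLin_apply, Matrix.mulVec, dotProduct,
    Finset.mul_sum]
  refine Finset.sum_congr rfl fun a _ => ?_
  have h1 : (fun i : (Lᶜ : Finset (Fin n)) => if h : (i : Fin n) ∈ Lᶜ then a ⟨i, h⟩ else x i) =
      a := by
    ext i; rw [dif_pos i.2]
  have h2 : (fun i : L => if h : (i : Fin n) ∈ Lᶜ then a ⟨i, h⟩ else x i) =
      fun i : L => x i := by
    ext i; rw [dif_neg (by simp)]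
  rw [h1, h2, mul_left_comm]

theorem labProduct_update_of_notMem {L : Finset (Fin n)} {b : Fin n} (hb : b ∉ L)
    (v : (i : Fin n) → LocalState (d i)) (y : LocalState (d b)) :
    labProduct L (Function.update v b y) = labProduct L v := by
  ext c
  simp only [labProduct]
  refine Finset.prod_congr rfl fun i _ => ?_
  rw [Function.update_of_ne]
  rintro h; exact hb (h ▸ i.2)

theorem labProduct_update_apply {L : Finset (Fin n)} {a : Fin n} (ha : a ∈ L)
    (v : (i : Fin n) → LocalState (d i)) (x : LocalState (d a)) (c : LabBasis d L) :
    labProduct L (Function.update v a x) c =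
      x (c ⟨a, ha⟩) * ∏ i ∈ Finset.univ.erase (⟨a, ha⟩ : L), v i (c i) := by
  simp only [labProduct]
  rw [← Finset.mul_prod_erase _ _ (Finset.mem_univ (⟨a, ha⟩ : L))]
  congr 1
  · simp
  · refine Finset.prod_congr rfl fun i hi => ?_
    rw [Function.update_of_ne]
    intro h
    exact (Finset.mem_erase.1 hi).1 (Subtype.ext h)

/-- The embedding of the space of party `a` into that of a group `L` that contains it, with fixed
local vectors at the other parties. -/
def slot {L : Finset (Fin n)} (v : (i : Fin n) → LocalState (d i)) {a : Fin n} (ha : a ∈ L) :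
    LocalState (d a) →ₗ[ℂ] LabState d L where
  toFun x := labProduct L (Function.update v a x)
  map_add' x y := by
    ext c; simp only [PiLp.add_apply, labProduct_update_apply ha, add_mul]
  map_smul' r x := by
    ext c
    simp only [PiLp.smul_apply, labProduct_update_apply ha, RingHom.id_apply, smul_eq_mul,
      mul_assoc]

/-- The fixed vectors have norm one, so they contribute a factor `1` each: the embedding is
isometric. -/
theorem inner_slot {L : Finset (Fin n)} {v : (i : Fin n) → LocalState (d i)}
    (hv : ∀ i, inner ℂ (v i) (v i) = (1 : ℂ)) {a : Fin n} (ha : a ∈ L) (x y : LocalState (d a)) :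
    inner ℂ (slot v ha x) (slot v ha y) = (inner ℂ x y : ℂ) := by
  simp only [slot, LinearMap.coe_mk, AddHom.coe_mk]
  rw [inner_labProduct, Fintype.prod_eq_single ⟨a, ha⟩]
  · simp
  · intro i hi
    have : (i : Fin n) ≠ a := fun h => hi (Subtype.ext h)
    rw [Function.update_of_ne this, Function.update_of_ne this, hv]

/-- When the two active parties lie in different groups, a block state is a product across the
bipartition, and each side depends linearly on one local vector. -/
theorem productVector_update_update_left {L : Finset (Fin n)} (v : (i : Fin n) → LocalState (d i))
    {a b : Fin n} (ha : a ∈ L) (hb : b ∈ Lᶜ) (x : LocalState (d a)) (y : LocalState (d b)) :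
    productVector (Function.update (Function.update v a x) b y) =
      combine (slot v ha x) (slot v hb y) := by
  have hab : a ≠ b := fun h => Finset.mem_compl.1 hb (h ▸ ha)
  rw [productVector_eq_combine L, labProduct_update_of_notMem (Finset.mem_compl.1 hb)]
  refine congrArg (combine _) ?_
  rw [Function.update_comm hab, labProduct_update_of_notMem (by simpa using ha)]
  rfl

theorem productVector_update_update_right {L : Finset (Fin n)} (v : (i : Fin n) → LocalState (d i))
    {a b : Fin n} (ha : a ∈ Lᶜ) (hb : b ∈ L) (x : LocalState (d a)) (y : LocalState (d b)) :
    productVector (Function.update (Function.update v a x) b y) =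
      combine (slot v hb y) (slot v ha x) := by
  have hab : a ≠ b := fun h => Finset.mem_compl.1 ha (h ▸ hb)
  rw [Function.update_comm hab, productVector_update_update_left]

/-- An isometric embedding between spaces of equal dimension is onto. -/
theorem slot_singleton_surjective {v : (i : Fin n) → LocalState (d i)}
    (hv : ∀ i, inner ℂ (v i) (v i) = (1 : ℂ)) (a : Fin n) :
    Function.Surjective (slot v (Finset.mem_singleton_self a)) := by
  have hinj : Function.Injective (slot v (Finset.mem_singleton_self a)) := by
    rw [← LinearMap.ker_eq_bot, LinearMap.ker_eq_bot']
    intro x hx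
    have := inner_slot hv (Finset.mem_singleton_self a) x x
    rw [hx, inner_zero_left] at this
    exact inner_self_eq_zero.1 this.symm
  refine (LinearMap.injective_iff_surjective_of_finrank_eq_finrank ?_).1 hinj
  rw [finrank_euclideanSpace, finrank_euclideanSpace, Fintype.card_pi]
  simp only [Fintype.card_fin]
  rw [Finset.prod_coe_sort {a} d, Finset.prod_singleton]

end Combine

/-! ## Measurements -/

section Measure

variable {X : Type} [Fintype X] [DecidableEq X]

theorem inner_toEuclideanLin_toEuclideanLin (M : Matrix X X ℂ) (f g : EuclideanSpace ℂ X) :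
    inner ℂ (Matrix.toEuclideanLin M f) (Matrix.toEuclideanLin M g) =
      (inner ℂ f (Matrix.toEuclideanLin (M.conjTranspose * M) g) : ℂ) := by
  rw [← LinearMap.adjoint_inner_right, ← Matrix.toEuclideanLin_conjTranspose_eq_adjoint]
  simp [Matrix.toLpLin_apply, Matrix.mulVec_mulVec]

/-- Completeness in terms of inner products. It passes orthogonality from all outcomes back to the
state before the measurement, and it makes the scale factors of the outcomes add up to the previous
one. -/
theorem Measurement.sum_inner_op (μ : Measurement X) (f g : EuclideanSpace ℂ X) :
    ∑ k, inner ℂ (Matrix.toEuclideanLin (μ.op k) f) (Matrix.toEuclideanLin (μ.op k) g) =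
      (inner ℂ f g : ℂ) := by
  simp only [inner_toEuclideanLin_toEuclideanLin]
  rw [← inner_sum, ← LinearMap.sum_apply, ← map_sum, μ.complete]
  simp

theorem conjTranspose_mul_self_eq_smul_one {M : Matrix X X ℂ} {c : ℂ}
    (h : ∀ f g : EuclideanSpace ℂ X, inner ℂ (Matrix.toEuclideanLin M f)
      (Matrix.toEuclideanLin M g) = c * inner ℂ f g) :
    M.conjTranspose * M = c • (1 : Matrix X X ℂ) := by
  apply Matrix.toEuclideanLin.injective
  ext1 g
  refine ext_inner_left ℂ fun f => ?_
  rw [← inner_toEuclideanLin_toEuclideanLin, h, map_smul, LinearMap.smul_apply, inner_smul_right]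
  simp

end Measure

/-! ## Local indistinguishability across a bipartition -/

section Bipartition

variable {n : ℕ} {d : Fin n → ℕ} {L : Finset (Fin n)}

/-- States that a protocol distinguishes with certainty are orthogonal. -/
theorem LOCC.DistinguishesFrom.inner_eq_zero {S : Set (MultiState d)} (P : LOCC d {L, Lᶜ})
    {K : MultiState d → MultiState d} (hP : P.DistinguishesFrom S K) {ψ φ : MultiState d}
    (hψ : ψ ∈ S) (hφ : φ ∈ S) (hne : ψ ≠ φ) {f f' : LabState d L} {g g' : LabState d Lᶜ}
    (hKψ : K ψ = combine f g) (hKφ : K φ = combine f' g') :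
    inner ℂ f f' * inner ℂ g g' = (0 : ℂ) := by
  induction P generalizing K f f' g g' with
  | announce s =>
    rw [← inner_combine, ← hKψ, ← hKφ]
    -- If both images were nonzero, one announcement would have to name two different states.
    by_cases h : K ψ = 0
    · rw [h, inner_zero_left]
    by_cases h' : K φ = 0
    · rw [h', inner_zero_right]
    exact absurd ((hP ψ hψ h).trans (hP φ hφ h').symm) hne
  | measure L' hL' μ next ih =>
    rcases hL' with h | h
    · subst h
      rw [← μ.sum_inner_op, Finset.sum_mul]
      refine Finset.sum_eq_zero fun k _ => ih k (hP k) ?_ ?_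
      · simp only [hKψ, applyLocal_combine]
      · simp only [hKφ, applyLocal_combine]
    · obtain rfl : L' = Lᶜ := h
      rw [← μ.sum_inner_op, Finset.mul_sum]
      refine Finset.sum_eq_zero fun k _ => ih k (hP k) ?_ ?_
      · simp only [hKψ, applyLocal_compl_combine]
      · simp only [hKφ, applyLocal_compl_combine]

/-- If both local operators are multiples of isometries, then no protocol distinguishes the images
of the states of a bipartite set in which orthogonality preservation is rigid. -/
theorem not_distinguishesFrom_of_rigid {E F : Type*} [NormedAddCommGroup E] [InnerProductSpace ℂ E]
    [NormedAddCommGroup F] [InnerProductSpace ℂ F] (R : E → F → Prop)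
    (hRE : ∀ T : E →ₗ[ℂ] LabState d L, (∀ x y x' y', R x y → R x' y' →
      inner ℂ x x' = (0 : ℂ) → inner ℂ y y' ≠ (0 : ℂ) → inner ℂ (T x) (T x') = (0 : ℂ)) →
      ∃ c : ℂ, ∀ x x', inner ℂ (T x) (T x') = c * inner ℂ x x')
    (hRF : ∀ U : F →ₗ[ℂ] LabState d Lᶜ, (∀ x y x' y', R x y → R x' y' →
      inner ℂ y y' = (0 : ℂ) → inner ℂ x x' ≠ (0 : ℂ) → inner ℂ (U y) (U y') = (0 : ℂ)) →
      ∃ c : ℂ, ∀ y y', inner ℂ (U y) (U y') = c * inner ℂ y y')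
    (hR0 : ∀ x y, R x y → x ≠ 0 ∧ y ≠ 0)
    (hR2 : ∃ x y x' y', R x y ∧ R x' y' ∧ inner ℂ x x' * inner ℂ y y' = (0 : ℂ))
    {S : Set (MultiState d)} (Ψ : E → F → MultiState d) (hS : ∀ x y, R x y → Ψ x y ∈ S)
    (hΨ : ∀ x y x' y', inner ℂ (Ψ x y) (Ψ x' y') = (inner ℂ x x' * inner ℂ y y' : ℂ))
    (P : LOCC d {L, Lᶜ}) (K : MultiState d → MultiState d)
    (T : E →ₗ[ℂ] LabState d L) (U : F →ₗ[ℂ] LabState d Lᶜ)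
    (hK : ∀ x y, K (Ψ x y) = combine (T x) (U y)) {c c' : ℂ} (hc : c ≠ 0) (hc' : c' ≠ 0)
    (hT : ∀ x x', inner ℂ (T x) (T x') = c * inner ℂ x x')
    (hU : ∀ y y', inner ℂ (U y) (U y') = c' * inner ℂ y y') :
    ¬ P.DistinguishesFrom S K := by
  have hne : ∀ x y x' y', R x y → inner ℂ x x' * inner ℂ y y' = (0 : ℂ) → Ψ x y ≠ Ψ x' y' := by
    intro x y x' y' h h0 he
    rw [← hΨ, ← he, hΨ] at h0
    rcases mul_eq_zero.1 h0 with h1 | h1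
    · exact (hR0 x y h).1 (inner_self_eq_zero.1 h1)
    · exact (hR0 x y h).2 (inner_self_eq_zero.1 h1)
  obtain ⟨x₀, y₀, x₁, y₁, h₀, h₁, h₀₁⟩ := hR2
  -- The invariant along the chosen branch: the block has been transformed by `T ⊗ U`, both nonzero
  -- multiples of isometries.
  induction P generalizing K T U c c' with
  | announce s =>
    intro hP
    have hK0 : ∀ x y, R x y → K (Ψ x y) ≠ 0 := by
      intro x y h h0
      have h1 : (inner ℂ (K (Ψ x y)) (K (Ψ x y)) : ℂ) = 0 := by rw [h0, inner_zero_left]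
      rw [hK, inner_combine, hT, hU] at h1
      have hx : (inner ℂ x x : ℂ) ≠ 0 := fun h' => (hR0 x y h).1 (inner_self_eq_zero.1 h')
      have hy : (inner ℂ y y : ℂ) ≠ 0 := fun h' => (hR0 x y h).2 (inner_self_eq_zero.1 h')
      exact mul_ne_zero (mul_ne_zero hc hx) (mul_ne_zero hc' hy) h1
    exact hne _ _ _ _ h₀ h₀₁ ((hP _ (hS _ _ h₀) (hK0 _ _ h₀)).trans
      (hP _ (hS _ _ h₁) (hK0 _ _ h₁)).symm)
  | measure L' hL' μ next ih =>
    intro hP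
    rcases hL' with h | h
    · subst h
      have hKk : ∀ k x y, applyLocal L' (μ.op k) (K (Ψ x y)) =
          combine ((Matrix.toEuclideanLin (μ.op k) ∘ₗ T) x) (U y) := by
        intro k x y
        rw [hK, applyLocal_combine]; rfl
      have hE : ∀ k, ∃ e : ℂ, ∀ x x', inner ℂ ((Matrix.toEuclideanLin (μ.op k) ∘ₗ T) x)
          ((Matrix.toEuclideanLin (μ.op k) ∘ₗ T) x') = e * inner ℂ x x' := by
        intro k
        -- The rest of the protocol still succeeds after outcome `k`, so the post-measurement states
        -- are orthogonal. `U` keeps the overlap of `y` and `y'` nonzero, hence the orthogonality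
        -- must come from the measured side.
        refine hRE _ fun x y x' y' h h' hx hy => ?_
        have := (hP k).inner_eq_zero _ (hS _ _ h) (hS _ _ h')
          (hne _ _ _ _ h (by rw [hx, zero_mul])) (hKk k x y) (hKk k x' y')
        rw [hU] at this
        exact (mul_eq_zero.1 this).resolve_right (mul_ne_zero hc' hy)
      choose e he using hE
      have hsum : (∑ k, e k) * inner ℂ x₀ x₀ = c * inner ℂ x₀ x₀ := by
        rw [← hT, ← μ.sum_inner_op, Finset.sum_mul]
        exact Finset.sum_congr rfl fun k _ => (he k x₀ x₀).symm
      have hx0 : (inner ℂ x₀ x₀ : ℂ) ≠ 0 := fun h' => (hR0 _ _ h₀).1 (inner_self_eq_zero.1 h')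
      -- The factors sum to `c ≠ 0`, so some outcome excludes no state of the block; the induction
      -- continues there.
      obtain ⟨k, -, hk⟩ : ∃ k ∈ Finset.univ, e k ≠ 0 :=
        Finset.exists_ne_zero_of_sum_ne_zero (by rw [mul_right_cancel₀ hx0 hsum]; exact hc)
      exact ih k _ _ U (hKk k) hk hc' (he k) hU (hP k)
    · obtain rfl : L' = Lᶜ := h
      have hKk : ∀ k x y, applyLocal Lᶜ (μ.op k) (K (Ψ x y)) =
          combine (T x) ((Matrix.toEuclideanLin (μ.op k) ∘ₗ U) y) := by
        intro k x y
        rw [hK, applyLocal_compl_combine]; rfl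
      have hE : ∀ k, ∃ e : ℂ, ∀ y y', inner ℂ ((Matrix.toEuclideanLin (μ.op k) ∘ₗ U) y)
          ((Matrix.toEuclideanLin (μ.op k) ∘ₗ U) y') = e * inner ℂ y y' := by
        intro k
        refine hRF _ fun x y x' y' h h' hy hx => ?_
        have := (hP k).inner_eq_zero _ (hS _ _ h) (hS _ _ h')
          (hne _ _ _ _ h (by rw [hy, mul_zero])) (hKk k x y) (hKk k x' y')
        rw [hT] at this
        exact (mul_eq_zero.1 this).resolve_left (mul_ne_zero hc hx)
      choose e he using hE
      have hsum : (∑ k, e k) * inner ℂ y₀ y₀ = c' * inner ℂ y₀ y₀ := by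
        rw [← hU, ← μ.sum_inner_op, Finset.sum_mul]
        exact Finset.sum_congr rfl fun k _ => (he k y₀ y₀).symm
      have hy0 : (inner ℂ y₀ y₀ : ℂ) ≠ 0 := fun h' => (hR0 _ _ h₀).2 (inner_self_eq_zero.1 h')
      obtain ⟨k, -, hk⟩ : ∃ k ∈ Finset.univ, e k ≠ 0 :=
        Finset.exists_ne_zero_of_sum_ne_zero (by rw [mul_right_cancel₀ hy0 hsum]; exact hc')
      exact ih k _ T _ (hKk k) hc hk hT (he k) (hP k)

end Bipartition

/-! ## Blocks -/

section Block

variable {n : ℕ} {d : Fin n → ℕ}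

/-- The local vectors of the parties outside a bipartite set: `|1⟩` at party `c`, otherwise
`|0⟩`. -/
def baseVec (d : Fin n → ℕ) (c i : Fin n) : LocalState (d i) :=
  ket (d i) (if i = c then 1 else 0)

theorem inner_baseVec_self (hd : ∀ i, 2 ≤ d i) (c i : Fin n) :
    inner ℂ (baseVec d c i) (baseVec d c i) = (1 : ℂ) := by
  have := hd i
  rw [baseVec, inner_ket_ket (by split_ifs <;> omega), if_pos rfl]

/-- The product vector with `x` at party `a`, `y` at party `b`, and `baseVec` elsewhere. -/
def blockVec (d : Fin n → ℕ) (a b c : Fin n) (x : LocalState (d a)) (y : LocalState (d b)) :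
    MultiState d :=
  productVector (Function.update (Function.update (baseVec d c) a x) b y)

theorem mem_block {a b c : Fin n} {x : LocalState (d a)} {y : LocalState (d b)}
    (h : BipartitePair (d a) (d b) x y) : blockVec d a b c x y ∈ block d a b c :=
  ⟨x, y, h, rfl⟩

theorem inner_blockVec (hd : ∀ i, 2 ≤ d i) {a b : Fin n} (hab : a ≠ b) (c : Fin n)
    (x : LocalState (d a)) (y : LocalState (d b)) (x' : LocalState (d a)) (y' : LocalState (d b)) :
    inner ℂ (blockVec d a b c x y) (blockVec d a b c x' y') =
      (inner ℂ x x' * inner ℂ y y' : ℂ) := by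
  have ha : a ∈ ({a} : Finset (Fin n)) := Finset.mem_singleton_self a
  have hb : b ∈ ({a} : Finset (Fin n))ᶜ := by simpa using hab.symm
  simp only [blockVec]
  rw [productVector_update_update_left _ ha hb, productVector_update_update_left _ ha hb,
    inner_combine, inner_slot (inner_baseVec_self hd c), inner_slot (inner_baseVec_self hd c)]

theorem exists_bipartitePair_inner_eq_zero {p q : ℕ} (hp : 3 ≤ p) : ∃ x y x' y',
    BipartitePair p q x y ∧ BipartitePair p q x' y' ∧ inner ℂ x x' * inner ℂ y y' = (0 : ℂ) :=
  ⟨_, _, _, _, .left 1 le_rfl (by omega), .left 2 (by omega) (by omega), by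
    rw [inner_ket_ket_of_ne (by omega) (by omega), zero_mul]⟩

/-- A set that contains a block on two parties in different groups is locally indistinguishable. -/
theorem locallyIndistinguishable_of_block_subset (hd : ∀ i, 2 ≤ d i) {a b : Fin n}
    (ha3 : 3 ≤ d a) (hab : d a ≤ d b) {c : Fin n} {S : Set (MultiState d)}
    (hS : block d a b c ⊆ S) {L : Finset (Fin n)} (h : a ∈ L ↔ b ∉ L) :
    LocallyIndistinguishable {L, Lᶜ} S := by
  rintro ⟨P, hP⟩
  have hne : a ≠ b := by rintro rfl; tauto
  have hv := inner_baseVec_self hd c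
  obtain ⟨x₀, y₀, x₁, y₁, h₀, h₁, h₀₁⟩ :=
    exists_bipartitePair_inner_eq_zero (p := d a) (q := d b) ha3
  by_cases ha : a ∈ L
  · have hb : b ∈ Lᶜ := Finset.mem_compl.2 (h.1 ha)
    exact not_distinguishesFrom_of_rigid (BipartitePair (d a) (d b))
      (exists_inner_map_map_eq_left ha3 hab) (exists_inner_map_map_eq_right ha3 hab)
      (fun _ _ => bipartitePair_ne_zero ha3 hab) ⟨x₀, y₀, x₁, y₁, h₀, h₁, h₀₁⟩
      (blockVec d a b c) (fun _ _ h => hS (mem_block h)) (inner_blockVec hd hne c)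
      P _ _ _ (productVector_update_update_left (baseVec d c) ha hb) one_ne_zero one_ne_zero
      (fun x x' => by rw [inner_slot hv, one_mul]) (fun y y' => by rw [inner_slot hv, one_mul]) hP
  · have hb : b ∈ L := by tauto
    have ha' : a ∈ Lᶜ := Finset.mem_compl.2 ha
    -- Here `L` holds the second factor, so the two factors and their rigidity statements are
    -- exchanged.
    exact not_distinguishesFrom_of_rigid (fun y x => BipartitePair (d a) (d b) x y)
      (fun T hT => exists_inner_map_map_eq_right ha3 hab T fun x y x' y' => hT y x y' x')
      (fun U hU => exists_inner_map_map_eq_left ha3 hab U fun x y x' y' => hU y x y' x')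
      (fun _ _ h => (bipartitePair_ne_zero ha3 hab h).symm)
      ⟨y₀, x₀, y₁, x₁, h₀, h₁, by rw [mul_comm]; exact h₀₁⟩
      (fun y x => blockVec d a b c x y) (fun _ _ h => hS (mem_block h))
      (fun y x y' x' => by rw [inner_blockVec hd hne c, mul_comm])
      P _ _ _ (fun y x => productVector_update_update_right (baseVec d c) ha' hb x y)
      one_ne_zero one_ne_zero
      (fun x x' => by rw [inner_slot hv, one_mul]) (fun y y' => by rw [inner_slot hv, one_mul]) hP

theorem blockVec_ne_of_inner_eq_zero (hd : ∀ i, 2 ≤ d i) {a b : Fin n} (ha3 : 3 ≤ d a)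
    (hab : d a ≤ d b) (hne : a ≠ b) (c : Fin n) {x x' : LocalState (d a)} {y y' : LocalState (d b)}
    (h : BipartitePair (d a) (d b) x y) (h0 : inner ℂ x x' * inner ℂ y y' = (0 : ℂ)) :
    blockVec d a b c x y ≠ blockVec d a b c x' y' := by
  intro he
  rw [← inner_blockVec hd hne c, ← he, inner_blockVec hd hne c] at h0
  have := bipartitePair_ne_zero ha3 hab h
  rcases mul_eq_zero.1 h0 with h1 | h1
  · exact this.1 (inner_self_eq_zero.1 h1)
  · exact this.2 (inner_self_eq_zero.1 h1)

/-- For a single party the embedding is onto, so scaling inner products on its image determines the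
whole POVM element. -/
theorem isTrivial_of_inner_slot {i : Fin n} {v : (i : Fin n) → LocalState (d i)}
    (hv : ∀ i, inner ℂ (v i) (v i) = (1 : ℂ)) (μ : Measurement (LabBasis d {i}))
    (h : ∀ k, ∃ c : ℂ, ∀ x x' : LocalState (d i),
      inner ℂ (Matrix.toEuclideanLin (μ.op k) (slot v (Finset.mem_singleton_self i) x))
        (Matrix.toEuclideanLin (μ.op k) (slot v (Finset.mem_singleton_self i) x')) =
        c * inner ℂ x x') : μ.IsTrivial := by
  intro k
  obtain ⟨c, hc⟩ := h k
  refine ⟨c, conjTranspose_mul_self_eq_smul_one fun f g => ?_⟩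
  obtain ⟨x, rfl⟩ := slot_singleton_surjective hv i f
  obtain ⟨x', rfl⟩ := slot_singleton_surjective hv i g
  rw [hc, inner_slot hv]

theorem isTrivial_left_of_block_subset (hd : ∀ i, 2 ≤ d i) {a b : Fin n} (ha3 : 3 ≤ d a)
    (hab : d a ≤ d b) (hne : a ≠ b) {c : Fin n} {S : Set (MultiState d)} (hS : block d a b c ⊆ S)
    (μ : Measurement (LabBasis d {a})) (hμ : IsOrthogonalityPreserving S (fun ψ => ψ) a μ) :
    μ.IsTrivial := by
  have hv := inner_baseVec_self hd c
  have hb : b ∈ ({a} : Finset (Fin n))ᶜ := by simpa using hne.symm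
  refine isTrivial_of_inner_slot hv μ fun k => ?_
  refine exists_inner_map_map_eq_left ha3 hab (Matrix.toEuclideanLin (μ.op k) ∘ₗ slot _ _)
    fun x y x' y' h h' hx hy => ?_
  have := hμ k _ (hS (mem_block h)) _ (hS (mem_block h'))
    (blockVec_ne_of_inner_eq_zero hd ha3 hab hne c h (by rw [hx, zero_mul]))
  simp only [blockVec] at this
  rw [productVector_update_update_left _ (Finset.mem_singleton_self a) hb,
    productVector_update_update_left _ (Finset.mem_singleton_self a) hb, applyLocal_combine,
    applyLocal_combine, inner_combine, inner_slot hv hb] at this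
  exact (mul_eq_zero.1 this).resolve_right hy

theorem isTrivial_right_of_block_subset (hd : ∀ i, 2 ≤ d i) {a b : Fin n} (ha3 : 3 ≤ d a)
    (hab : d a ≤ d b) (hne : a ≠ b) {c : Fin n} {S : Set (MultiState d)} (hS : block d a b c ⊆ S)
    (μ : Measurement (LabBasis d {b})) (hμ : IsOrthogonalityPreserving S (fun ψ => ψ) b μ) :
    μ.IsTrivial := by
  have hv := inner_baseVec_self hd c
  have ha : a ∈ ({b} : Finset (Fin n))ᶜ := by simpa using hne
  refine isTrivial_of_inner_slot hv μ fun k => ?_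
  refine exists_inner_map_map_eq_right ha3 hab (Matrix.toEuclideanLin (μ.op k) ∘ₗ slot _ _)
    fun x y x' y' h h' hy hx => ?_
  have := hμ k _ (hS (mem_block h)) _ (hS (mem_block h'))
    (blockVec_ne_of_inner_eq_zero hd ha3 hab hne c h (by rw [hy, mul_zero]))
  simp only [blockVec] at this
  rw [productVector_update_update_right _ ha (Finset.mem_singleton_self b),
    productVector_update_update_right _ ha (Finset.mem_singleton_self b), applyLocal_combine,
    applyLocal_combine, inner_combine, inner_slot hv ha] at this
  exact (mul_eq_zero.1 this).resolve_right hx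

/-- If no party has a nontrivial orthogonality-preserving measurement, then the set is locally
irreducible. -/
theorem locallyIrreducible_of_forall_isTrivial {S : Set (MultiState d)}
    (hS0 : ∀ ψ ∈ S, ψ ≠ 0) (h : ∀ i (μ : Measurement (LabBasis d {i})),
      IsOrthogonalityPreserving S (fun ψ => ψ) i μ → μ.IsTrivial) : LocallyIrreducible S := by
  rintro ⟨K, hK, -, ψ, hψ, h0⟩
  -- The first measurement of any sequence would be a nontrivial orthogonality-preserving one on `S`
  -- itself.
  have hid : K = fun ψ => ψ := by
    clear h0
    induction hK with
    | start => rfl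
    | step K hK i μ hμ hnt k ih => subst ih; exact absurd (h i μ hμ) hnt
  subst hid
  exact hS0 ψ hψ h0

end Block

/-! ## The union of the blocks -/

section Union

variable {n : ℕ}

/-- The party that shares the bipartite set of a block with party `i ≥ 1`. -/
def partner (hn : 4 ≤ n) (i : Fin n) : Fin n :=
  if (i : ℕ) = 1 then ⟨0, i.pos⟩ else ⟨1, by omega⟩

/-- The party with local state `|1⟩` in the block of party `i ≥ 1`. -/
def controlParty (hn : 4 ≤ n) (i : Fin n) : Fin n :=
  if (i : ℕ) = 1 then ⟨n - 1, by omega⟩ else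
    if (i : ℕ) = 2 then ⟨0, i.pos⟩ else ⟨i - 1, by omega⟩

theorem coe_partner (hn : 4 ≤ n) (i : Fin n) :
    (partner hn i : ℕ) = if (i : ℕ) = 1 then 0 else 1 := by
  unfold partner; split_ifs <;> rfl

theorem coe_control (hn : 4 ≤ n) (i : Fin n) :
    (controlParty hn i : ℕ) = if (i : ℕ) = 1 then n - 1 else if (i : ℕ) = 2 then 0 else i - 1 := by
  unfold controlParty; split_ifs <;> rfl

theorem partner_ne (hn : 4 ≤ n) (i : Fin n) : partner hn i ≠ i := by
  intro h
  have := coe_partner hn i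
  rw [h] at this; split_ifs at this <;> omega

theorem partner_le (hn : 4 ≤ n) {i : Fin n} (hi : 1 ≤ (i : ℕ)) : partner hn i ≤ i := by
  rw [Fin.le_def, coe_partner]; split_ifs <;> omega

theorem blockG_eq (hn : 4 ≤ n) (d : Fin n → ℕ) {i : Fin n} (hi : (i : ℕ) ≤ n - 1) :
    blockG hn d i hi = block d (partner hn i) i (controlParty hn i) := by
  obtain ⟨i, hin⟩ := i
  unfold blockG partner controlParty
  by_cases h1 : i = 1
  · subst h1; simp
  · by_cases h2 : i = 2 <;> simp [h1, h2]

theorem unionOfBlocks_eq (hn : 4 ≤ n) (d : Fin n → ℕ) :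
    unionOfBlocks hn d =
      ⋃ i : {i : Fin n // 1 ≤ (i : ℕ)}, block d (partner hn i) i (controlParty hn i) := by
  ext ψ
  simp only [unionOfBlocks, Set.mem_ofPred_eq, Set.mem_iUnion]
  constructor
  · rintro ⟨k, h1, hk, h⟩
    refine ⟨⟨⟨k, by omega⟩, h1⟩, ?_⟩
    rw [← blockG_eq hn d (i := ⟨k, by omega⟩) hk]
    exact h
  · rintro ⟨i, h⟩
    refine ⟨i, i.2, by omega, ?_⟩
    rw [blockG_eq]; exact h

theorem block_subset_unionOfBlocks (hn : 4 ≤ n) (d : Fin n → ℕ) {i : Fin n} (hi : 1 ≤ (i : ℕ)) :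
    block d (partner hn i) i (controlParty hn i) ⊆ unionOfBlocks hn d := by
  rw [unionOfBlocks_eq]
  exact Set.subset_iUnion (fun i : {i : Fin n // 1 ≤ (i : ℕ)} =>
    block d (partner hn i) i (controlParty hn i)) ⟨i, hi⟩

/-- Two different blocks have local states `|1⟩` and `|0⟩` at some party. -/
theorem exists_party_separating_blocks (hn : 4 ≤ n) {i j : Fin n} (hi : 1 ≤ (i : ℕ))
    (hij : i < j) : ∃ r, r = controlParty hn i ∧ r ≠ partner hn i ∧ r ≠ i ∧
      r ≠ controlParty hn j ∧ r ≠ partner hn j ∧ r ≠ j ∨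
      r = controlParty hn j ∧ r ≠ partner hn j ∧ r ≠ j ∧
      r ≠ controlParty hn i ∧ r ≠ partner hn i ∧ r ≠ i := by
  have hij' : (i : ℕ) < j := hij
  simp only [Fin.ext_iff, ne_eq, coe_control, coe_partner]
  -- The control party of the earlier block works unless it is the active party `j` of the later
  -- one. This happens only for `i = 1`, `j = n - 1`; then the control party of `j` has index `n - 2
  -- ≥ 2` and lies outside block `i`.
  by_cases h : (i : ℕ) = 1 ∧ (j : ℕ) = n - 1
  · refine ⟨controlParty hn j, .inr ?_⟩
    rw [coe_control]
    refine ⟨?_, ?_, ?_, ?_, ?_, ?_⟩ <;> split_ifs <;> omega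
  · refine ⟨controlParty hn i, .inl ?_⟩
    rw [coe_control]
    refine ⟨?_, ?_, ?_, ?_, ?_, ?_⟩ <;> split_ifs <;> first | omega | exact not_false

theorem inner_blockVec_of_separated {d : Fin n → ℕ} (hd : ∀ i, 2 ≤ d i) {a b c a' b' c' r : Fin n}
    (hc : r = c) (ha : r ≠ a) (hb : r ≠ b) (hc' : r ≠ c') (ha' : r ≠ a') (hb' : r ≠ b')
    (x : LocalState (d a)) (y : LocalState (d b)) (x' : LocalState (d a'))
    (y' : LocalState (d b')) :
    inner ℂ (blockVec d a b c x y) (blockVec d a' b' c' x' y') = (0 : ℂ) := by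
  rw [blockVec, blockVec, inner_productVector]
  refine Finset.prod_eq_zero (Finset.mem_univ r) ?_
  have := hd r
  rw [Function.update_of_ne hb, Function.update_of_ne ha, Function.update_of_ne hb',
    Function.update_of_ne ha', baseVec, baseVec, if_pos hc, if_neg hc']
  exact inner_ket_ket_of_ne (by omega) one_ne_zero

-- Enumeration and orthogonality of all states, and the main properties

variable (hn : 4 ≤ n) {d : Fin n → ℕ}

/-- Labels for the states in the union of the blocks. -/
abbrev StateIndex (hn : 4 ≤ n) (d : Fin n → ℕ) : Type :=
  Σ i : {i : Fin n // 1 ≤ (i : ℕ)}, PairIndex (d (partner hn i)) (d i)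

/-- The state with a given label. -/
def stateVec (d : Fin n → ℕ) (s : StateIndex hn d) : MultiState d :=
  blockVec d (partner hn s.1) s.1 (controlParty hn s.1) (pairVec _ _ s.2).1 (pairVec _ _ s.2).2

theorem unionOfBlocks_eq_range (h3 : ∀ i, 3 ≤ d i) :
    unionOfBlocks hn d = Set.range (stateVec hn d) := by
  rw [unionOfBlocks_eq]
  ext ψ
  simp only [Set.mem_iUnion, Set.mem_range, Sigma.exists]
  refine exists_congr fun i => ⟨?_, ?_⟩
  · rintro ⟨x, y, h, rfl⟩
    obtain ⟨s, hs⟩ := (bipartitePair_iff (h3 _) x y).1 h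
    exact ⟨s, by rw [stateVec, hs]; rfl⟩
  · rintro ⟨s, rfl⟩
    exact mem_block ((bipartitePair_iff (h3 _) _ _).2 ⟨s, rfl⟩)

theorem bipartitePair_pairVec (h3 : ∀ i, 3 ≤ d i) (s : StateIndex hn d) :
    BipartitePair _ _ (pairVec _ _ s.2).1 (pairVec _ _ s.2).2 :=
  (bipartitePair_iff (h3 _) _ _).2 ⟨s.2, rfl⟩

theorem stateVec_isProductState (h3 : ∀ i, 3 ≤ d i) (hd : Monotone d) (s : StateIndex hn d) :
    IsProductState (stateVec hn d s) := by
  have h0 := bipartitePair_ne_zero (h3 _) (hd (partner_le hn s.1.2)) (bipartitePair_pairVec hn h3 s)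
  refine ⟨_, fun i => ?_, rfl⟩
  by_cases hb : i = s.1
  · subst hb; simpa using h0.2
  by_cases ha : i = partner hn s.1
  · subst ha
    rw [Function.update_of_ne hb, Function.update_self]
    exact h0.1
  · rw [Function.update_of_ne hb, Function.update_of_ne ha]
    have := h3 i
    exact ket_ne_zero (by split_ifs <;> omega)

theorem stateVec_ne_zero (h3 : ∀ i, 3 ≤ d i) (hd : Monotone d) (s : StateIndex hn d) :
    stateVec hn d s ≠ 0 := by
  obtain ⟨v, hv, h⟩ := stateVec_isProductState hn h3 hd s
  rw [h, ← inner_self_ne_zero (𝕜 := ℂ), inner_productVector]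
  exact Finset.prod_ne_zero_iff.2 fun i _ => inner_self_ne_zero.2 (hv i)

theorem inner_stateVec_of_ne (h3 : ∀ i, 3 ≤ d i) (hd : Monotone d) {s t : StateIndex hn d}
    (hst : s ≠ t) : inner ℂ (stateVec hn d s) (stateVec hn d t) = (0 : ℂ) := by
  have h2 : ∀ i, 2 ≤ d i := fun i => by have := h3 i; omega
  have key : ∀ s t : StateIndex hn d, (s.1 : Fin n) < t.1 →
      inner ℂ (stateVec hn d s) (stateVec hn d t) = (0 : ℂ) := by
    intro s t hlt
    obtain ⟨r, h | h⟩ := exists_party_separating_blocks hn s.1.2 hlt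
    · exact inner_blockVec_of_separated h2 h.1 h.2.1 h.2.2.1 h.2.2.2.1 h.2.2.2.2.1 h.2.2.2.2.2
        _ _ _ _
    · exact inner_eq_zero_symm.1 (inner_blockVec_of_separated h2 h.1 h.2.1 h.2.2.1 h.2.2.2.1
        h.2.2.2.2.1 h.2.2.2.2.2 _ _ _ _)
  rcases lt_trichotomy (s.1 : Fin n) t.1 with h | h | h
  · exact key s t h
  · obtain ⟨i, s⟩ := s
    obtain ⟨j, t⟩ := t
    obtain rfl : i = j := Subtype.ext h
    have hne : s ≠ t := fun h' => hst (h' ▸ rfl)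
    simp only [stateVec]
    rw [inner_blockVec h2 (partner_ne hn i)]
    exact mul_eq_zero.2 (pairVec_orthogonal (h3 _) (hd (partner_le hn i.2)) hne)
  · exact inner_eq_zero_symm.1 (key t s h)

theorem stateVec_injective (h3 : ∀ i, 3 ≤ d i) (hd : Monotone d) :
    Function.Injective (stateVec hn d) := by
  intro s t h
  by_contra hne
  have := inner_stateVec_of_ne hn h3 hd hne
  rw [h] at this
  exact stateVec_ne_zero hn h3 hd t (inner_self_eq_zero.1 this)

theorem ncard_unionOfBlocks (h3 : ∀ i, 3 ≤ d i) (hd : Monotone d) :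
    (unionOfBlocks hn d).ncard =
      ∑ i ∈ Finset.univ.filter (fun i : Fin n => 1 ≤ (i : ℕ)), (2 * d i - 1) := by
  rw [unionOfBlocks_eq_range hn h3, ← Nat.card_coe_set_eq,
    Nat.card_range_of_injective (stateVec_injective hn h3 hd), Nat.card_eq_fintype_card,
    Fintype.card_sigma,
    Finset.sum_subtype (p := fun i : Fin n => 1 ≤ (i : ℕ)) _ (fun i => by simp)]
  exact Finset.sum_congr rfl fun i _ => card_pairIndex (h3 _) (hd (partner_le hn i.2))

theorem isOrthogonalSet_unionOfBlocks (h3 : ∀ i, 3 ≤ d i) (hd : Monotone d) :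
    IsOrthogonalSet (unionOfBlocks hn d) := by
  rw [unionOfBlocks_eq_range hn h3]
  constructor
  · rintro _ ⟨s, rfl⟩
    exact stateVec_ne_zero hn h3 hd s
  · rintro _ ⟨s, rfl⟩ _ ⟨t, rfl⟩ hne
    exact inner_stateVec_of_ne hn h3 hd fun h => hne (h ▸ rfl)

/-- Every bipartition separates the two parties of the bipartite set in some block. -/
theorem exists_block_across (L : Finset (Fin n)) (hL : L.Nonempty) (hL' : Lᶜ.Nonempty) :
    ∃ i : Fin n, 1 ≤ (i : ℕ) ∧ (partner hn i ∈ L ↔ i ∉ L) := by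
  by_contra! h
  have hiff : ∀ i : Fin n, 1 ≤ (i : ℕ) → (partner hn i ∈ L ↔ i ∈ L) := fun i hi => by
    rcases h i hi with h | h <;> tauto
  have h01 := hiff ⟨1, by omega⟩ le_rfl
  simp only [partner, if_true] at h01
  -- If no block were cut, every party would be on the side of the centre of the star, index `1`.
  have hall : ∀ i : Fin n, i ∈ L ↔ (⟨1, by omega⟩ : Fin n) ∈ L := by
    intro i
    by_cases h0 : (i : ℕ) = 0
    · rw [← h01, show i = ⟨0, by omega⟩ from Fin.ext h0]
    by_cases h1 : (i : ℕ) = 1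
    · rw [show i = ⟨1, by omega⟩ from Fin.ext h1]
    · have := hiff i (by omega)
      rw [partner, if_neg h1] at this
      exact this.symm
  obtain ⟨i, hi⟩ := hL
  obtain ⟨j, hj⟩ := hL'
  exact Finset.mem_compl.1 hj ((hall j).2 ((hall i).1 hi))

theorem genuinelyNonlocal_unionOfBlocks (h3 : ∀ i, 3 ≤ d i) (hd : Monotone d) :
    GenuinelyNonlocal (unionOfBlocks hn d) := by
  intro L hL hL'
  obtain ⟨i, hi, h⟩ := exists_block_across hn L hL hL'
  exact locallyIndistinguishable_of_block_subset (fun i => by have := h3 i; omega) (h3 _)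
    (hd (partner_le hn hi)) (block_subset_unionOfBlocks hn d hi) h

theorem locallyIrreducible_unionOfBlocks (h3 : ∀ i, 3 ≤ d i) (hd : Monotone d) :
    LocallyIrreducible (unionOfBlocks hn d) := by
  have h2 : ∀ i, 2 ≤ d i := fun i => by have := h3 i; omega
  have h1n : 1 < n := by omega
  refine locallyIrreducible_of_forall_isTrivial (isOrthogonalSet_unionOfBlocks hn h3 hd).1
    fun i μ hμ => ?_
  by_cases hi : 1 ≤ (i : ℕ)
  · exact isTrivial_right_of_block_subset h2 (h3 _) (hd (partner_le hn hi)) (partner_ne hn i)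
      (block_subset_unionOfBlocks hn d hi) μ hμ
  -- Index `0` is the one party that is never a second factor; it is the first factor in the block
  -- of index `1`.
  · have h1 : 1 ≤ ((⟨1, h1n⟩ : Fin n) : ℕ) := le_rfl
    obtain rfl : i = partner hn ⟨1, h1n⟩ := by
      rw [Fin.ext_iff, coe_partner]; simp; omega
    exact isTrivial_left_of_block_subset h2 (h3 _) (hd (partner_le hn h1)) (partner_ne hn _)
      (block_subset_unionOfBlocks hn d h1) μ hμ

end Union

end

theorem theorem4 {n : ℕ} (hn : 4 ≤ n) (d : Fin n → ℕ) (hd : Monotone d)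
    (h3 : 3 ≤ d ⟨0, by omega⟩) :
    (unionOfBlocks hn d).ncard =
        ∑ i ∈ Finset.univ.filter (fun i : Fin n => 1 ≤ (i : ℕ)), (2 * d i - 1) ∧
      (∀ ψ ∈ unionOfBlocks hn d, IsProductState ψ) ∧
      IsOrthogonalSet (unionOfBlocks hn d) ∧
      GenuinelyNonlocalTypeII (unionOfBlocks hn d) := by
  have h3' : ∀ i, 3 ≤ d i := fun i => h3.trans (hd (Fin.mk_le_of_le_val (Nat.zero_le _)))
  refine ⟨ncard_unionOfBlocks hn h3' hd, ?_, isOrthogonalSet_unionOfBlocks hn h3' hd,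
    genuinelyNonlocal_unionOfBlocks hn h3' hd, locallyIrreducible_unionOfBlocks hn h3' hd⟩
  rw [unionOfBlocks_eq_range hn h3']
  rintro _ ⟨s, rfl⟩
  exact stateVec_isProductState hn h3' hd s
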